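/- Let $N\ge 1$, $k\in\frac12\mathbb Z$, let $M\in\mathrm{Mat}_N(\mathbb Q)$ be symmetric and positive definite, and write $e(x)=\exp(2\pi i x)$, $q^m=e(m\tau)$, $\zeta^r=e({}^t r z)$, $M[v]={}^t v M v$. Let $\mathrm{Mp}_2(\mathbb Z)$ be the group of pairs $(\gamma,\omega)$ with $\gamma=\left(\begin{smallmatrix}a&b\\c&d\end{smallmatrix}\right)\in\mathrm{SL}_2(\mathbb Z)$ and $\omega:\mathbb H\to\mathbb C$ holomorphic with $\omega(\tau)^2=c\tau+d$, with product $(\gamma_1,\omega_1)(\gamma_2,\omega_2)=(\gamma_1\gamma_2,(\omega_1\circ\gamma_2)\,\omega_2)$. Let $\widetilde\Gamma^{J(N)}$ be the group of triples $g=((\gamma,\omega),(\lambda,\mu),\kappa)$ with $(\gamma,\omega)\in\mathrm{Mp}_2(\mathbb Z)$, $\lambda,\mu\in\mathbb Z^N$, $\kappa\in\mathrm{Mat}_N(\mathbb Z)$ and product $$g_1g_2=\big((\gamma_1,\omega_1)(\gamma_2,\omega_2),\,(\tilde\lambda+\lambda_2,\tilde\mu+\mu_2),\,\kappa_1+\kappa_2+\tilde\lambda\,{}^t\mu_2-\tilde\mu\,{}^t\lambda_2\big),\qquad(\tilde\lambda,\tilde\mu)=(\lambda_1,\mu_1)\gamma_2,$$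 and let $\rho$ be a unitary representation of $\widetilde\Gamma^{J(N)}$ on a finite dimensional complex vector space $V$. A Jacobi form $\phi\in J_{k,M}(\rho)$ is a holomorphic function $\phi:\mathbb H\times\mathbb C^N\to V$ such that (i) for all $g=((\gamma,\omega),(\lambda,\mu),\kappa)\in\widetilde\Gamma^{J(N)}$, $$\omega(\tau)^{-2k}\,e\Big(\tfrac12\Big(-\tfrac{c\,M[z+\lambda\tau+\mu]}{c\tau+d}+M[\lambda]\tau+2\,{}^t\lambda Mz+\mathrm{tr}\big(M(\kappa+\mu\,{}^t\lambda)\big)\Big)\Big)\,\rho(g)^{-1}\phi\Big(\tfrac{a\tau+b}{c\tau+d},\tfrac{z+\lambda\tau+\mu}{c\tau+d}\Big)=\phi(\tau,z);$$ (ii) for all $\alpha,\beta\in\mathbb Q^N$, the function $e(\tfrac12M[\alpha]\tau)\,\phi(\tau,\alpha\tau+\beta)$ is bounded as $\mathrm{Im}\,\tau\to\infty$. Put $$\mathrm{rd}(M)=\max_{\xi\in\mathbb R^N}\ \min_{\pm,\ \xi'\in\mathbb Z^N}M[\pm\xi+\xi'].$$ **Proposition.** Every $\phi\in J_{k,M}(\rho)$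 has a unique expansion $\phi(\tau,z)=\sum_{m\in\mathbb R,\,r\in\mathbb Q^N}c(\phi;m,r)\,q^m\zeta^r$ with $c(\phi;m,r)\in V$, unconditionally convergent at every point, and: (a) if $c(\phi;m,r)=0$ for all $r\in\mathbb Q^N$ and all $m$ with $0\le m<\frac{k}{12}+1+\frac12\mathrm{rd}(M)$, then $\phi=0$; (b) if $\rho([0,\mu,0])=\mathrm{id}$ for every $\mu\in\mathbb Z^N$ with $M\mu\in\mathbb Z^N$, where $[0,\mu,0]=((I_2,1),(0,\mu),0)$, then it already suffices for $\phi=0$ that $c(\phi;m,r)=0$ for all $r\in M\mathbb Z^N+\mathbb Z^N$ and all $m$ with $0\le m<\frac{k}{12}+1+\frac12\mathrm{rd}(M)$. -/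

import Mathlib

open scoped MatrixGroups Manifold Matrix

noncomputable section

namespace JacobiForms

open UpperHalfPlane hiding I

/-- `e(x) = exp(2 π i x)`. -/
def e (x : ℂ) : ℂ := Complex.exp (2 * Real.pi * Complex.I * x)

/-- The automorphy factor `c τ + d`. -/
def cd (γ : SL(2, ℤ)) (τ : ℍ) : ℂ := (γ 1 0 : ℂ) * (τ : ℂ) + (γ 1 1 : ℂ)

theorem cd_eq_denom (γ : SL(2, ℤ)) (τ : ℍ) : cd γ τ = denom γ τ := by
  simp [cd, ModularGroup.denom_apply]

theorem cd_ne_zero (γ : SL(2, ℤ)) (τ : ℍ) : cd γ τ ≠ 0 := by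
  rw [cd_eq_denom]; exact denom_ne_zero _ _

theorem cd_mul (γ δ : SL(2, ℤ)) (τ : ℍ) : cd (γ * δ) τ = cd γ (δ • τ) * cd δ τ := by
  have h := cd_ne_zero δ τ
  simp only [cd, coe_specialLinearGroup_apply] at h ⊢
  simp only [Matrix.SpecialLinearGroup.coe_mul, Matrix.mul_apply, Fin.sum_univ_two,
    algebraMap_int_eq, Int.coe_castRingHom, Complex.ofReal_intCast, Int.cast_add, Int.cast_mul]
  field_simp
  ring

theorem cd_one (τ : ℍ) : cd 1 τ = 1 := by simp [cd]

theorem mdifferentiable_smul_SL (γ : SL(2, ℤ)) : MDiff (fun τ : ℍ => γ • τ) :=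
  mdifferentiable_smul (g := (γ : GL (Fin 2) ℝ)) (by simp)

/-- The metaplectic group `Mp₂(ℤ)`: pairs `(γ, ω)` of `γ ∈ SL₂(ℤ)` and a holomorphic square root
`ω : ℍ → ℂ` of `τ ↦ c τ + d`. -/
@[ext]
structure Mp where
  γ : SL(2, ℤ)
  ω : ℍ → ℂ
  holo : MDiff ω
  sq : ∀ τ, ω τ ^ 2 = cd γ τ

namespace Mp

theorem ω_ne_zero (g : Mp) (τ : ℍ) : g.ω τ ≠ 0 := fun h =>
  cd_ne_zero g.γ τ (by rw [← g.sq, h]; simp)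

instance : Mul Mp where
  mul g h :=
    { γ := g.γ * h.γ
      ω := fun τ => g.ω (h.γ • τ) * h.ω τ
      holo := (g.holo.comp (mdifferentiable_smul_SL h.γ)).mul h.holo
      sq := fun τ => by rw [mul_pow, g.sq, h.sq, cd_mul] }

instance : One Mp where
  one := { γ := 1, ω := fun _ => 1, holo := mdifferentiable_const, sq := fun τ => by simp [cd_one] }

instance : Inv Mp where
  inv g :=
    { γ := g.γ⁻¹
      ω := fun τ => (g.ω (g.γ⁻¹ • τ))⁻¹
      holo := by
        have h := g.holo.comp (mdifferentiable_smul_SL g.γ⁻¹)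
        rw [UpperHalfPlane.mdifferentiable_iff] at h ⊢
        exact h.inv fun z _ => g.ω_ne_zero _
      sq := fun τ => by
        have h := cd_mul g.γ g.γ⁻¹ τ
        rw [mul_inv_cancel, cd_one] at h
        rw [inv_pow, g.sq]
        exact (eq_inv_of_mul_eq_one_right h.symm).symm }

@[simp] theorem mul_γ (g h : Mp) : (g * h).γ = g.γ * h.γ := rfl
@[simp] theorem mul_ω (g h : Mp) (τ : ℍ) : (g * h).ω τ = g.ω (h.γ • τ) * h.ω τ := rfl
@[simp] theorem one_γ : (1 : Mp).γ = 1 := rfl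
@[simp] theorem one_ω (τ : ℍ) : (1 : Mp).ω τ = 1 := rfl
@[simp] theorem inv_γ (g : Mp) : (g⁻¹).γ = g.γ⁻¹ := rfl
@[simp] theorem inv_ω (g : Mp) (τ : ℍ) : (g⁻¹).ω τ = (g.ω (g.γ⁻¹ • τ))⁻¹ := rfl

instance : Group Mp :=
  Group.ofLeftAxioms
    (fun a b c => Mp.ext (by simp [mul_assoc]) (by funext τ; simp [mul_smul, mul_assoc]))
    (fun a => Mp.ext (by simp) (by funext τ; simp))
    (fun a => Mp.ext (by simp) (by funext τ; simp [a.ω_ne_zero]))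

end Mp

/-- The underlying set of the metaplectic, centrally extended Jacobi group
`Mp₂(ℤ) ⋉ (Mat_{N,2}(ℤ) ט Mat_N(ℤ))`, with elements `((γ, ω), (lam, mu), kap)`. -/
@[ext]
structure JacobiGroup (N : ℕ) where
  mp : Mp
  lam : Fin N → ℤ
  mu : Fin N → ℤ
  kap : Matrix (Fin N) (Fin N) ℤ

namespace JacobiGroup

variable {N : ℕ}

/-- First column of `(lam, mu) γ`. -/
def actL (lam mu : Fin N → ℤ) (γ : SL(2, ℤ)) : Fin N → ℤ := fun i => lam i * γ 0 0 + mu i * γ 1 0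

/-- Second column of `(lam, mu) γ`. -/
def actR (lam mu : Fin N → ℤ) (γ : SL(2, ℤ)) : Fin N → ℤ := fun i => lam i * γ 0 1 + mu i * γ 1 1

/-- With `(λ, μ) = (λ₁, μ₁) γ₂`, the product of `(g₁, (λ₁, μ₁), κ₁)` and `(g₂, (λ₂, μ₂), κ₂)` is
`(g₁ g₂, (λ + λ₂, μ + μ₂), κ₁ + κ₂ + λ μ₂ᵗ - μ λ₂ᵗ)`. -/
instance : Mul (JacobiGroup N) where
  mul a b :=
    { mp := a.mp * b.mp
      lam := actL a.lam a.mu b.mp.γ + b.lam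
      mu := actR a.lam a.mu b.mp.γ + b.mu
      kap := a.kap + b.kap + Matrix.vecMulVec (actL a.lam a.mu b.mp.γ) b.mu
        - Matrix.vecMulVec (actR a.lam a.mu b.mp.γ) b.lam }

instance : One (JacobiGroup N) where
  one := { mp := 1, lam := 0, mu := 0, kap := 0 }

instance : Inv (JacobiGroup N) where
  inv a :=
    { mp := a.mp⁻¹
      lam := -actL a.lam a.mu a.mp.γ⁻¹
      mu := -actR a.lam a.mu a.mp.γ⁻¹
      kap := -a.kap + Matrix.vecMulVec a.lam a.mu - Matrix.vecMulVec a.mu a.lam }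

theorem mul_mp (a b : JacobiGroup N) : (a * b).mp = a.mp * b.mp := rfl
theorem mul_lam (a b : JacobiGroup N) :
    (a * b).lam = actL a.lam a.mu b.mp.γ + b.lam := rfl
theorem mul_mu (a b : JacobiGroup N) :
    (a * b).mu = actR a.lam a.mu b.mp.γ + b.mu := rfl
theorem mul_kap (a b : JacobiGroup N) :
    (a * b).kap = a.kap + b.kap + Matrix.vecMulVec (actL a.lam a.mu b.mp.γ) b.mu
        - Matrix.vecMulVec (actR a.lam a.mu b.mp.γ) b.lam := rfl
theorem one_mp : (1 : JacobiGroup N).mp = 1 := rfl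
theorem one_lam : (1 : JacobiGroup N).lam = 0 := rfl
theorem one_mu : (1 : JacobiGroup N).mu = 0 := rfl
theorem one_kap : (1 : JacobiGroup N).kap = 0 := rfl
theorem inv_mp (a : JacobiGroup N) : (a⁻¹).mp = a.mp⁻¹ := rfl
theorem inv_lam (a : JacobiGroup N) : (a⁻¹).lam = -actL a.lam a.mu a.mp.γ⁻¹ := rfl
theorem inv_mu (a : JacobiGroup N) : (a⁻¹).mu = -actR a.lam a.mu a.mp.γ⁻¹ := rfl
theorem inv_kap (a : JacobiGroup N) :
    (a⁻¹).kap = -a.kap + Matrix.vecMulVec a.lam a.mu - Matrix.vecMulVec a.mu a.lam := rfl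

theorem det_eq (γ : SL(2, ℤ)) : γ 0 0 * γ 1 1 - γ 0 1 * γ 1 0 = 1 := by
  have h := γ.det_coe
  rwa [Matrix.det_fin_two] at h

instance : Group (JacobiGroup N) :=
  Group.ofLeftAxioms
    (fun a b c => by
      have h := det_eq c.mp.γ
      ext i j
      · simp [mul_mp, mul_assoc]
      · simp [mul_mp, mul_assoc]
      · simp [mul_lam, mul_mu, mul_mp, actL, actR, Matrix.mul_apply, Fin.sum_univ_two]; ring
      · simp [mul_lam, mul_mu, mul_mp, actL, actR, Matrix.mul_apply, Fin.sum_univ_two]; ring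
      · simp [mul_lam, mul_mu, mul_mp, mul_kap, actL, actR, Matrix.mul_apply, Fin.sum_univ_two,
          Matrix.vecMulVec_apply]
        linear_combination (-(a.lam i * b.mp.γ 0 0 + a.mu i * b.mp.γ 1 0) * b.mu j
          + (a.lam i * b.mp.γ 0 1 + a.mu i * b.mp.γ 1 1) * b.lam j) * h)
    (fun a => by
      ext i j <;> simp [mul_mp, mul_lam, mul_mu, mul_kap, one_mp, one_lam, one_mu, one_kap, actL,
        actR, Matrix.vecMulVec_apply])
    (fun a => by
      have h := det_eq a.mp.γ
      ext i j
      · simp [mul_mp, inv_mp, one_mp]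
      · simp [mul_mp, inv_mp, one_mp]
      · simp [mul_lam, inv_lam, inv_mu, one_lam, actL, actR, Matrix.adjugate_fin_two]
        linear_combination (-a.lam i) * h
      · simp [mul_mu, inv_lam, inv_mu, one_mu, actL, actR, Matrix.adjugate_fin_two]
        linear_combination (-a.mu i) * h
      · simp [mul_kap, inv_kap, inv_lam, inv_mu, one_kap, actL, actR, Matrix.adjugate_fin_two,
          Matrix.vecMulVec_apply]
        linear_combination (a.mu i * a.lam j - a.lam i * a.mu j) * h)

/-- The element `[lam, mu, kap]ᴶ` of the Heisenberg-like subgroup. -/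
def heis (lam mu : Fin N → ℤ) (kap : Matrix (Fin N) (Fin N) ℤ) : JacobiGroup N :=
  { mp := 1, lam := lam, mu := mu, kap := kap }

end JacobiGroup

variable {N : ℕ}

/-- The entries of a rational matrix, viewed in `ℂ`. -/
abbrev toC (M : Matrix (Fin N) (Fin N) ℚ) : Matrix (Fin N) (Fin N) ℂ := M.map (fun q => (q : ℂ))

/-- The entries of a rational matrix, viewed in `ℝ`. -/
abbrev toR (M : Matrix (Fin N) (Fin N) ℚ) : Matrix (Fin N) (Fin N) ℝ := M.map (fun q => (q : ℝ))

/-- `A[v] = vᵗ A v`. -/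
def qf {R : Type*} [CommRing R] (A : Matrix (Fin N) (Fin N) R) (v : Fin N → R) : R :=
  v ⬝ᵥ (A *ᵥ v)

/-- `z + λ τ + μ`. -/
def shift (g : JacobiGroup N) (τ : ℍ) (z : Fin N → ℂ) : Fin N → ℂ :=
  fun i => z i + (g.lam i : ℂ) * τ + (g.mu i : ℂ)

/-- The exponential factor of index `M`:
`e(½ (-c M[z + λ τ + μ] / (c τ + d) + M[λ] τ + 2 λᵗ M z + tr(M (κ + μ λᵗ))))`. -/
def expFactor (M : Matrix (Fin N) (Fin N) ℚ) (g : JacobiGroup N) (τ : ℍ) (z : Fin N → ℂ) : ℂ :=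
  e ((1 / 2) *
    (-(g.mp.γ 1 0 : ℂ) * qf (toC M) (shift g τ z) / cd g.mp.γ τ
      + qf (toC M) (fun i => (g.lam i : ℂ)) * τ
      + 2 * ((fun i => (g.lam i : ℂ)) ⬝ᵥ (toC M *ᵥ z))
      + (toC M * (g.kap + Matrix.vecMulVec g.mu g.lam).map (fun n => (n : ℂ))).trace))

section
variable {V : Type*} [NormedAddCommGroup V] [NormedSpace ℂ V]

/-- The slash action of weight `twok / 2`, index `M` and type `ρ` on functions `ℍ × ℂᴺ → V`. -/
def slash (twok : ℤ) (M : Matrix (Fin N) (Fin N) ℚ) (ρ : Representation ℂ (JacobiGroup N) V)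
    (φ : ℍ → (Fin N → ℂ) → V) (g : JacobiGroup N) (τ : ℍ) (z : Fin N → ℂ) : V :=
  (g.mp.ω τ ^ (-twok) * expFactor M g τ z) •
    ρ g⁻¹ (φ (g.mp.γ • τ) (fun i => shift g τ z i / cd g.mp.γ τ))

/-- Jacobi forms of weight `twok / 2`, index `M` and type `ρ`. -/
structure IsJacobiForm (twok : ℤ) (M : Matrix (Fin N) (Fin N) ℚ)
    (ρ : Representation ℂ (JacobiGroup N) V) (φ : ℍ → (Fin N → ℂ) → V) : Prop where
  holo : DifferentiableOn ℂ (fun p : ℂ × (Fin N → ℂ) => φ (ofComplex p.1) p.2) {p | 0 < p.1.im}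
  slash_eq : ∀ g : JacobiGroup N, slash twok M ρ φ g = φ
  bounded : ∀ α β : Fin N → ℚ, IsBoundedAtImInfty fun τ : ℍ =>
    e ((1 / 2) * qf (toC M) (fun i => (α i : ℂ)) * τ) •
      φ τ (fun i => (α i : ℂ) * τ + (β i : ℂ))

/-- `c` is a family of Fourier coefficients of `φ`: the series
`∑ c(m, r) q^m ζ^r`, with `m ∈ ℝ` and `r ∈ ℚᴺ`, converges unconditionally to `φ` at every point. -/
def IsFourierExpansion (φ : ℍ → (Fin N → ℂ) → V) (c : ℝ → (Fin N → ℚ) → V) : Prop :=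
  ∀ (τ : ℍ) (z : Fin N → ℂ),
    HasSum (fun p : ℝ × (Fin N → ℚ) =>
      (e (p.1 * τ) * e ((fun i => (p.2 i : ℂ)) ⬝ᵥ z)) • c p.1 p.2) (φ τ z)

end

/-- `rd(M) = max_{ξ ∈ ℝᴺ} min_{±, ξ' ∈ ℤᴺ} M[± ξ + ξ']`. -/
def rd (M : Matrix (Fin N) (Fin N) ℚ) : ℝ :=
  ⨆ ξ : Fin N → ℝ, ⨅ p : ℤˣ × (Fin N → ℤ),
    qf (toR M) (fun i => ((p.1 : ℤ) : ℝ) * ξ i + (p.2 i : ℝ))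

/-- `r ∈ M ℤᴺ + ℤᴺ`. -/
def InSumLattice (M : Matrix (Fin N) (Fin N) ℚ) (r : Fin N → ℚ) : Prop :=
  ∃ a b : Fin N → ℤ, r = M *ᵥ (fun i => (a i : ℚ)) + fun i => (b i : ℚ)

end JacobiForms

end

noncomputable section
namespace JacobiForms

open UpperHalfPlane hiding I
open MeasureTheory Set Filter Topology

/-! Existence. On the span of the values of `φ` the centre acts by the scalars `e(½ tr(Mκ))`, which
are roots of unity. Taking determinants on eigenspaces in the Heisenberg relations forces the
translations `[0, μ, 0]` to have finite order there (`exists_pow_eq_one_of_inner_map`), so `φ` is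
`Lℤᴺ`-periodic in `z`. Diagonalising the unitary `ρ(T)` makes each coordinate of `φ`, up to a factor
`e(tτ)`, a periodic holomorphic function on a tube, which has an absolutely convergent Laurent
series (`exists_hasSum_tube`).

Uniqueness. Averaging over translates isolates one frequency of an absolutely convergent
trigonometric series and bounds its coefficient by the sup norm (`norm_tsum_frequency_le`). The same
principle turns boundedness at the cusp into vanishing of `c(m, r)` for `m < 0`.

Vanishing. Put `B = k/12 + 1`. The Heisenberg group carries `c(m, r)` to `c(m - r·l + ½M[l], r -
Ml)`, preserving `m - ½M⁻¹[r]`. If the coefficients below `B + ½ rd(M)` vanish, every `l` gives a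
lower bound for the translated exponent. By the definition of `rd(M)`, some `l` makes the translated
exponent exceed the invariant by at most `½ rd(M)`, so `m - ½M⁻¹[r] ≥ B`. Hence all exponents `m +
r·α + ½M[α]` of `e(½M[α]τ) φ(τ, ατ+β)` are at least `B`, for every real `α`
(`IsJacobiForm.exponent_ge`).

The quantity `|η|^(-2k) ‖e(½M[α]τ) φ(τ, ατ+β)‖` is invariant under the Jacobi group acting on `(τ,
α, β)`, because `ρ` is unitary. Since `|η|^(-2k)` grows like `exp(2π(k/12) Im τ)`, the quantity
decays at the cusp, uniformly in `α, β`. A nonzero value would give a global maximum; the maximum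
principle in `τ` at fixed `(α, β)` makes it constant there, against the decay.

For (b), triviality of `[0, μ, 0]` when `Mμ` is integral forces `r·μ ∈ ℤ` on the support of `c`, and
lattice biduality puts `r` in `Mℤᴺ + ℤᴺ`. -/

theorem e_add (x y : ℂ) : e (x + y) = e x * e y := by
  simp [e, mul_add, Complex.exp_add]

theorem e_zero : e 0 = 1 := by simp [e]

theorem e_ne_zero (x : ℂ) : e x ≠ 0 := Complex.exp_ne_zero _

theorem e_neg (x : ℂ) : e (-x) = (e x)⁻¹ := by simp [e, Complex.exp_neg]

theorem e_sum {ι : Type*} (s : Finset ι) (f : ι → ℂ) : e (∑ i ∈ s, f i) = ∏ i ∈ s, e (f i) := by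
  simp [e, Finset.mul_sum, Complex.exp_sum]

theorem e_intCast (n : ℤ) : e n = 1 := by
  rw [e, mul_comm]
  exact Complex.exp_int_mul_two_pi_mul_I n

theorem norm_e (x : ℂ) : ‖e x‖ = Real.exp (-2 * Real.pi * x.im) := by
  rw [e, Complex.norm_exp]
  congr 1
  simp

theorem norm_e_ofReal (x : ℝ) : ‖e x‖ = 1 := by simp [norm_e]

@[fun_prop]
theorem differentiable_e : Differentiable ℂ e := by
  unfold e
  fun_prop

@[fun_prop]
theorem continuous_e : Continuous e := differentiable_e.continuous

theorem exists_e_eq {x : ℂ} (hx : ‖x‖ = 1) : ∃ t : ℝ, e t = x := by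
  obtain ⟨t, ht⟩ := (Complex.norm_eq_one_iff x).1 hx
  refine ⟨t / (2 * Real.pi), ?_⟩
  rw [← ht, e]
  congr 1
  have : (Real.pi : ℂ) ≠ 0 := by exact_mod_cast Real.pi_ne_zero
  push_cast
  field_simp

/-! ### Laurent series of periodic holomorphic functions on tubes -/

section Tube

variable {ι : Type*} [Fintype ι]

/-- The box `∏ (0, 1]`. -/
def unitBox (ι : Type*) : Set (ι → ℝ) := {x | ∀ i, x i ∈ Ioc (0 : ℝ) (0 + 1)}

theorem measurableSet_unitBox : MeasurableSet (unitBox ι) :=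
  MeasurableSet.univ_pi' fun _ => measurableSet_Ioc

omit [Fintype ι] in
theorem unitBox_subset : unitBox ι ⊆ Icc 0 1 := fun x hx =>
  ⟨fun i => (hx i).1.le, fun i => by simpa using (hx i).2⟩

theorem volume_unitBox : volume (unitBox ι) = 1 := by
  have : unitBox ι = univ.pi fun _ => Ioc (0 : ℝ) (0 + 1) := by ext; simp [unitBox]
  rw [this, Real.volume_pi_Ioc]
  simp

omit [Fintype ι] in
/-- A continuous `ℤ`-periodic function descends to the torus. -/
theorem exists_torus_lift {g : (ι → ℝ) → ℂ} (hg : Continuous g)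
    (hper : ∀ (x : ι → ℝ) (n : ι → ℤ), g (fun i => x i + n i) = g x) :
    ∃ f : C(UnitAddTorus ι, ℂ), ∀ x : ι → ℝ, f (fun i => (x i : UnitAddCircle)) = g x := by
  have hq : IsOpenQuotientMap (Pi.map fun (_ : ι) (x : ℝ) => (x : UnitAddCircle)) :=
    IsOpenQuotientMap.piMap fun _ => QuotientAddGroup.isOpenQuotientMap_mk
  let q : C(ι → ℝ, UnitAddTorus ι) := ⟨_, hq.continuous⟩
  have hq' : IsQuotientMap q := hq.isQuotientMap
  have hfac : Function.FactorsThrough (⟨g, hg⟩ : C(ι → ℝ, ℂ)) q := by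
    intro x y hxy
    have : ∀ i, ∃ n : ℤ, x i = y i + n := by
      intro i
      have h := congrFun hxy i
      have h0 : ((x i - y i : ℝ) : UnitAddCircle) = 0 := by
        rw [AddCircle.coe_sub, sub_eq_zero]
        exact h
      obtain ⟨n, hn⟩ := (AddCircle.coe_eq_zero_iff 1).1 h0
      exact ⟨n, by simp at hn; linarith⟩
    choose n hn using this
    have : x = fun i => y i + n i := funext hn
    simp only [ContinuousMap.coe_mk]
    rw [this, hper]
  refine ⟨hq'.lift ⟨g, hg⟩ hfac, fun x => ?_⟩
  exact DFunLike.congr_fun (hq'.lift_comp ⟨g, hg⟩ hfac) x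

theorem setIntegral_unitBox_shift {g : (ι → ℝ) → ℂ} (hg : Continuous g)
    (hper : ∀ (x : ι → ℝ) (n : ι → ℤ), g (fun i => x i + n i) = g x) (a : ι → ℝ) :
    ∫ x in unitBox ι, g (x + a) = ∫ x in unitBox ι, g x := by
  obtain ⟨f, hf⟩ := exists_torus_lift hg hper
  have h := (UnitAddTorus.integral_preimage f 0).symm.trans (UnitAddTorus.integral_preimage f a)
  simp only [hf] at h
  refine Eq.trans ?_ h.symm
  rw [← (measurePreserving_add_right volume a).setIntegral_preimage_emb
    (measurableEmbedding_addRight a) g {x | ∀ i, x i ∈ Ioc (a i) (a i + 1)}]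
  congr 2
  ext x
  simp only [unitBox, mem_ofPred_eq, mem_preimage, Pi.add_apply, mem_Ioc]
  refine forall_congr' fun i => ?_
  constructor <;> rintro ⟨h1, h2⟩ <;> constructor <;> linarith

theorem integrableOn_unitBox {g : (ι → ℝ) → ℂ} (hg : Continuous g) :
    IntegrableOn g (unitBox ι) :=
  (hg.continuousOn.integrableOn_compact isCompact_Icc).mono_set unitBox_subset

/-- For a holomorphic periodic function on a tube, the zeroth Fourier coefficient along the real
torus over `y` does not depend on `y`. -/
theorem setIntegral_tube_eq {U : Set (ι → ℝ)} (hU : IsOpen U) (hUc : Convex ℝ U)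
    {F : (ι → ℂ) → ℂ} (hF : DifferentiableOn ℂ F {w | (fun i => (w i).im) ∈ U})
    (hper : ∀ (w : ι → ℂ) (n : ι → ℤ), (fun i => (w i).im) ∈ U → F (fun i => w i + n i) = F w)
    {y y' : ι → ℝ} (hy : y ∈ U) (hy' : y' ∈ U) :
    ∫ x in unitBox ι, F (fun i => x i + y i * Complex.I) =
      ∫ x in unitBox ι, F (fun i => x i + y' i * Complex.I) := by
  set d : ι → ℝ := y' - y with hd
  set Ω : Set (ι → ℂ) := {w | (fun i => (w i).im) ∈ U} with hΩ
  have hΩo : IsOpen Ω := hU.preimage (by fun_prop)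
  -- A complex parameter joining the two tori: `s = 0` lies over `y`, `s = I` lies over `y'`, and a
  -- real change of `s` only translates `x`.
  let P : (ι → ℝ) → ℂ → ι → ℂ := fun x s i => x i + y i * Complex.I + s * d i
  have hPc : Continuous fun p : (ι → ℝ) × ℂ => P p.1 p.2 := by
    refine continuous_pi fun i => ?_
    dsimp only [P]
    fun_prop
  let S : Set ℂ := {s | (fun i => y i + s.im * d i) ∈ U}
  have hSo : IsOpen S := hU.preimage (by fun_prop)
  have hSc : Convex ℝ S := by
    intro s hs t ht a b ha hb hab
    have := hUc hs ht ha hb hab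
    change _ ∈ U
    convert this using 1
    ext i
    simp only [Complex.add_im, Complex.smul_im, Pi.add_apply, Pi.smul_apply, smul_eq_mul]
    linear_combination (-y i) * hab
  have hPS : ∀ x s, s ∈ S → P x s ∈ Ω := by
    intro x s hs
    change _ ∈ U
    change _ ∈ U at hs
    convert hs using 1
    ext i
    simp [P]
  have hFd : ∀ w ∈ Ω, DifferentiableAt ℂ F w := fun w hw => hF.differentiableAt (hΩo.mem_nhds hw)
  have hFPc : ContinuousOn (fun p : (ι → ℝ) × ℂ => F (P p.1 p.2)) (univ ×ˢ S) :=
    hF.continuousOn.comp hPc.continuousOn fun p hp => hPS _ _ hp.2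
  have hxc : ∀ s ∈ S, Continuous fun x => F (P x s) := fun s hs =>
    hFPc.comp_continuous (by fun_prop : Continuous fun x : ι → ℝ => (x, s))
      fun x => ⟨mem_univ _, hs⟩
  have hsd : ∀ x, ∀ s ∈ S, HasDerivAt (fun s => F (P x s)) (fderiv ℂ F (P x s) fun i => d i) s := by
    intro x s hs
    refine (hFd _ (hPS x s hs)).hasFDerivAt.comp_hasDerivAt s ?_
    refine hasDerivAt_pi.2 fun i => ?_
    simpa [P] using ((hasDerivAt_id s).mul_const (d i : ℂ)).const_add (x i + y i * Complex.I)
  let g : ℂ → ℂ := fun s => ∫ x in unitBox ι, F (P x s)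
  have hg : ∀ s ∈ S, ∃ g', HasDerivAt g g' s := by
    intro s₀ hs₀
    obtain ⟨ε, hε, hεS⟩ := Metric.nhds_basis_closedBall.mem_iff.1 (hSo.mem_nhds hs₀)
    obtain ⟨r, hr, hrε⟩ : ∃ r > 0, 2 * r = ε := ⟨ε / 2, by positivity, by ring⟩
    obtain ⟨C, hC⟩ := ((isCompact_Icc (a := (0 : ι → ℝ)) (b := 1)).prod
      (isCompact_closedBall s₀ ε)).exists_bound_of_continuousOn
      (hFPc.mono (prod_mono (subset_univ _) hεS))
    have hball : ∀ s ∈ Metric.ball s₀ r, Metric.closedBall s r ⊆ Metric.closedBall s₀ ε := by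
      intro s hs
      refine Metric.closedBall_subset_closedBall' ?_
      have := Metric.mem_ball.1 hs
      linarith
    refine ⟨_, (hasDerivAt_integral_of_dominated_loc_of_deriv_le (μ := volume.restrict (unitBox ι))
      (F := fun s x => F (P x s)) (F' := fun s x => fderiv ℂ F (P x s) fun i => d i)
      (s := Metric.ball s₀ r) (bound := fun _ => C / r)
      (Metric.ball_mem_nhds _ hr) ?_ ?_ ?_ ?_ ?_ ?_).2⟩
    · filter_upwards [hSo.mem_nhds hs₀] with s hs
      exact (hxc s hs).aestronglyMeasurable
    · exact integrableOn_unitBox (hxc s₀ hs₀)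
    · exact ((measurable_fderiv_apply_const ℂ F _).comp
        (hPc.comp (by fun_prop : Continuous fun x : ι → ℝ => (x, s₀))).measurable).aestronglyMeasurable
    -- Cauchy's estimate on circles of radius `r = ε / 2`, which stay in the closed ball where `C`
    -- bounds the integrand, supplies the dominating constant `C / r`.
    · refine (ae_restrict_iff' measurableSet_unitBox).2 (Eventually.of_forall fun x hx s hs => ?_)
      have hsub := hball s hs
      rw [← (hsd x s (hεS (hsub (Metric.mem_closedBall_self hr.le)))).deriv]
      refine Complex.norm_deriv_le_of_forall_mem_sphere_norm_le hr ?_ fun t ht =>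
        hC (x, t) ⟨unitBox_subset hx, hsub (Metric.sphere_subset_closedBall ht)⟩
      refine DifferentiableOn.diffContOnCl fun t ht => ?_
      rw [closure_ball _ hr.ne'] at ht
      exact (hsd x t (hεS (hsub ht))).differentiableAt.differentiableWithinAt
    · have : IsFiniteMeasure (volume.restrict (unitBox ι)) :=
        ⟨by simp [volume_unitBox]⟩
      exact integrable_const _
    · refine Eventually.of_forall fun x s hs => ?_
      exact hsd x s (hεS (hball s hs (Metric.mem_closedBall_self hr.le)))
  have hgshift : ∀ s ∈ S, ∀ t : ℝ, g (s + t) = g s := by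
    intro s hs t
    have := setIntegral_unitBox_shift (hxc s hs) (fun x n => ?_) (t • d)
    · refine Eq.trans ?_ this
      refine setIntegral_congr_fun measurableSet_unitBox fun x _ => congrArg F ?_
      ext i
      simp [P]
      ring
    · rw [← hper _ n (hPS x s hs)]
      congr 1
      ext i
      simp [P]
      ring
  -- A holomorphic function that is constant along real directions has zero derivative.
  have hderiv : ∀ s ∈ S, deriv g s = 0 := by
    intro s hs
    obtain ⟨g', hg'⟩ := hg s hs
    have h0 : HasDerivAt (fun t : ℝ => s + (t : ℂ)) 1 0 := by
      simpa using (Complex.ofRealCLM.hasDerivAt (x := (0 : ℝ))).const_add s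
    have h1 : HasDerivAt (fun t : ℝ => g (s + t)) g' 0 := by
      have := HasDerivAt.comp_of_eq (h₂ := g) (0 : ℝ) hg' h0 (by simp)
      simpa [Function.comp_def] using this
    have h2 : HasDerivAt (fun t : ℝ => g (s + t)) 0 0 := by
      simp only [hgshift s hs]
      exact hasDerivAt_const _ _
    rw [hg'.deriv]
    exact h1.unique h2
  have h0 : (0 : ℂ) ∈ S := by simpa [S] using hy
  have h1 : Complex.I ∈ S := by simpa [S, hd] using hy'
  have := hSo.is_const_of_deriv_eq_zero hSc.isPreconnected
    (fun s hs => (hg s hs).choose_spec.differentiableAt.differentiableWithinAt) hderiv h0 h1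
  have e0 : ∀ x, P x 0 = fun i => x i + y i * Complex.I := fun x => by ext i; simp [P]
  have e1 : ∀ x, P x Complex.I = fun i => x i + y' i * Complex.I := fun x => by
    ext i
    simp [P, hd]
    ring
  simpa only [g, e0, e1] using this

theorem summable_pow_natAbs {r : ℝ} (h0 : 0 ≤ r) (h1 : r < 1) :
    Summable fun n : ℤ => r ^ n.natAbs := by
  refine Summable.of_nat_of_neg ?_ ?_ <;> simpa using summable_geometric_of_lt_one h0 h1

/-- Every finite set of multi-indices lies in a product of finite sets, on which the sum of products
factors. -/
theorem summable_pi_prod_of_nonneg {κ : Type*} {g : κ → ℝ} (h0 : 0 ≤ g)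
    (hs : Summable g) : Summable fun n : ι → κ => ∏ i, g (n i) := by
  classical
  refine summable_of_sum_le (c := ∏ _ : ι, ∑' n : κ, g n)
    (fun n => Finset.prod_nonneg fun i _ => h0 _) fun u => ?_
  calc ∑ n ∈ u, ∏ i, g (n i)
      ≤ ∑ n ∈ Fintype.piFinset fun i => u.image fun n => n i, ∏ i, g (n i) := by
        refine Finset.sum_le_sum_of_subset_of_nonneg (fun n hn => ?_)
          fun n _ _ => Finset.prod_nonneg fun i _ => h0 _
        exact Fintype.mem_piFinset.2 fun i => Finset.mem_image_of_mem _ hn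
    _ = ∏ i, ∑ m ∈ u.image fun n => n i, g m :=
        (Finset.prod_univ_sum (fun i => u.image fun n : ι → κ => n i) fun _ m => g m).symm
    _ ≤ ∏ _ : ι, ∑' n : κ, g n :=
        Finset.prod_le_prod (fun i _ => Finset.sum_nonneg fun _ _ => h0 _)
          fun i _ => hs.sum_le_tsum _ fun _ _ => h0 _

theorem mFourier_coe (n : ι → ℤ) (x : ι → ℝ) :
    UnitAddTorus.mFourier n (fun i => (x i : UnitAddCircle)) = e (∑ i, (n i : ℂ) * x i) := by
  rw [e_sum]
  refine Finset.prod_congr rfl fun i _ => ?_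
  rw [fourier_coe_apply, e]
  congr 1
  push_cast
  ring

theorem e_sum_add_intCast (n m : ι → ℤ) (w : ι → ℂ) :
    e (∑ i, (n i : ℂ) * (w i + m i)) = e (∑ i, (n i : ℂ) * w i) := by
  have : ∑ i, (n i : ℂ) * (w i + m i) = ∑ i, (n i : ℂ) * w i + ((∑ i, n i * m i : ℤ) : ℂ) := by
    push_cast
    rw [← Finset.sum_add_distrib]
    exact Finset.sum_congr rfl fun i _ => by ring
  rw [this, e_add, e_intCast, mul_one]

/-- A holomorphic function on a tube over a convex open set that is periodic with respect to the
integer lattice is the sum of an unconditionally convergent Laurent series. -/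
theorem exists_hasSum_tube {U : Set (ι → ℝ)} (hU : IsOpen U) (hUc : Convex ℝ U)
    {F : (ι → ℂ) → ℂ} (hF : DifferentiableOn ℂ F {w | (fun i => (w i).im) ∈ U})
    (hper : ∀ (w : ι → ℂ) (n : ι → ℤ), (fun i => (w i).im) ∈ U → F (fun i => w i + n i) = F w) :
    ∃ a : (ι → ℤ) → ℂ, ∀ w : ι → ℂ, (fun i => (w i).im) ∈ U →
      HasSum (fun n : ι → ℤ => e (∑ i, (n i : ℂ) * w i) * a n) (F w) := by
  rcases U.eq_empty_or_nonempty with rfl | ⟨y₀, hy₀⟩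
  · exact ⟨0, fun w hw => hw.elim⟩
  have him : ∀ x y : ι → ℝ, (fun i => ((x i : ℂ) + y i * Complex.I).im) = y := by
    intro x y
    ext i
    simp
  have hlift : ∀ y : U, ∃ f : C(UnitAddTorus ι, ℂ), ∀ x : ι → ℝ,
      f (fun i => (x i : UnitAddCircle)) = F fun i => x i + (y : ι → ℝ) i * Complex.I := by
    intro y
    refine exists_torus_lift
      (hF.continuousOn.comp_continuous (by fun_prop) fun x => ?_) fun x n => ?_
    · change _ ∈ U
      rw [him]
      exact y.2
    · rw [← hper (fun i => x i + (y : ι → ℝ) i * Complex.I) n (by rw [him]; exact y.2)]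
      congr 1
      ext i
      push_cast
      ring
  choose f hf using hlift
  let a : (ι → ℤ) → ℂ := fun n => ∫ x in unitBox ι,
    F (fun i => x i + y₀ i * Complex.I) * e (-∑ i, (n i : ℂ) * (x i + y₀ i * Complex.I))
  have hcoef : ∀ (y : U) n, UnitAddTorus.mFourierCoeff (f y) n =
      e (∑ i, (n i : ℂ) * ((y : ι → ℝ) i * Complex.I)) * a n := by
    intro y n
    have h := setIntegral_tube_eq hU hUc
      (F := fun w => F w * e (-∑ i, (n i : ℂ) * w i)) (hF.mul (by fun_prop))
      (fun w m hw => by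
        simp only
        rw [hper w m hw, e_neg, e_neg, e_sum_add_intCast]) y.2 hy₀
    change _ = _ * _
    rw [show a n = _ from h.symm, UnitAddTorus.mFourierCoeff_eq_integral _ _ 0,
      ← integral_const_mul]
    refine setIntegral_congr_fun measurableSet_unitBox fun x _ => ?_
    simp only [smul_eq_mul]
    rw [hf, mFourier_coe, mul_left_comm, ← e_add, mul_comm]
    congr 2
    rw [← Finset.sum_neg_distrib, ← Finset.sum_add_distrib]
    refine Finset.sum_congr rfl fun i _ => ?_
    simp only [Pi.neg_apply]
    push_cast
    ring
  have hnorm : ∀ (n : ι → ℤ) (y : ι → ℝ), ‖e (∑ i, (n i : ℂ) * (y i * Complex.I))‖ =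
      Real.exp (-2 * Real.pi * ∑ i, n i * y i) := by
    intro n y
    rw [norm_e]
    congr 2
    simp
  have hbound : ∀ (y : U) n, Real.exp (-2 * Real.pi * ∑ i, n i * (y : ι → ℝ) i) * ‖a n‖ ≤ ‖f y‖ := by
    intro y n
    rw [← hnorm, ← norm_mul, ← hcoef, UnitAddTorus.mFourierCoeff_eq_integral _ _ 0]
    refine (norm_setIntegral_le_of_norm_le_const (C := ‖f y‖) (s := unitBox ι)
      (by simp [volume_unitBox]) fun x _ => ?_).trans ?_
    · have h1 := (UnitAddTorus.mFourier (-n)).norm_coe_le_norm fun i => (x i : UnitAddCircle)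
      rw [UnitAddTorus.mFourier_norm] at h1
      rw [norm_smul]
      exact (mul_le_of_le_one_left (norm_nonneg _) h1).trans ((f y).norm_coe_le_norm _)
    · simp [Measure.real, volume_unitBox]
  classical
  have hsum : ∀ y : U, Summable (UnitAddTorus.mFourierCoeff (f y)) := by
    intro y
    obtain ⟨δ, hδ, hball⟩ := Metric.nhds_basis_closedBall.mem_iff.1 (hU.mem_nhds y.2)
    -- Moving from `y` to `y - δ sign(n)` multiplies the weight of the `n`-th coefficient by
    -- `exp(2πδ ∑ |n i|)`. Only finitely many sign vectors occur, so the coefficient bounds at these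
    -- points give geometric decay at `y`.
    let t : (ι → SignType) → ι → ℝ := fun s i => (y : ι → ℝ) i - δ * (s i : ℝ)
    have ht : ∀ s, t s ∈ U := by
      intro s
      refine hball ?_
      rw [Metric.mem_closedBall, dist_pi_le_iff hδ.le]
      intro i
      simp only [t, Real.dist_eq]
      cases s i <;> simp [abs_of_pos hδ, hδ.le]
    let C : ℝ := ∑ s, ‖f ⟨t s, ht s⟩‖
    refine Summable.of_norm_bounded (g := fun n : ι → ℤ =>
      C * ∏ i, Real.exp (-2 * Real.pi * δ) ^ (n i).natAbs)
      ((summable_pi_prod_of_nonneg (fun n => by positivity)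
        (summable_pow_natAbs (Real.exp_pos _).le ?_)).mul_left C) fun n => ?_
    · rw [Real.exp_lt_one_iff]
      have := Real.pi_pos
      nlinarith [mul_pos this hδ]
    · let s : ι → SignType := fun i => SignType.sign (n i : ℝ)
      have h1 := hbound ⟨t s, ht s⟩ n
      have h2 : ‖f ⟨t s, ht s⟩‖ ≤ C := Finset.single_le_sum
        (f := fun s => ‖f ⟨t s, ht s⟩‖) (fun _ _ => norm_nonneg _) (Finset.mem_univ s)
      rw [hcoef, norm_mul, hnorm]
      refine le_trans (le_of_eq ?_) (mul_le_mul_of_nonneg_right (h1.trans h2)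
        (Finset.prod_nonneg fun i _ => by positivity))
      have h3 : ∏ i, Real.exp (-2 * Real.pi * δ) ^ (n i).natAbs =
          Real.exp (-2 * Real.pi * ∑ i, δ * (n i).natAbs) := by
        rw [Finset.mul_sum, Real.exp_sum]
        refine Finset.prod_congr rfl fun i _ => ?_
        rw [← Real.exp_nat_mul]
        congr 1
        ring
      rw [h3, mul_right_comm (Real.exp _), ← Real.exp_add, ← mul_add, ← Finset.sum_add_distrib]
      congr 3
      refine Finset.sum_congr rfl fun i _ => ?_
      have h4 : ((n i).natAbs : ℝ) = n i * (s i : ℝ) := by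
        rw [self_mul_sign, Nat.cast_natAbs, Int.cast_abs]
      rw [h4]
      simp only [t]
      ring
  refine ⟨a, fun w hw => ?_⟩
  have h := UnitAddTorus.hasSum_mFourier_series_apply_of_summable (hsum ⟨_, hw⟩)
    (fun i => ((w i).re : UnitAddCircle))
  have hw' : (fun i => ((w i).re : ℂ) + ((w i).im : ℂ) * Complex.I) = w := by
    ext i
    exact Complex.re_add_im _
  rw [hf] at h
  simp only [hw'] at h
  convert h using 2 with n
  rw [hcoef, mFourier_coe, smul_eq_mul, mul_right_comm, ← e_add, ← Finset.sum_add_distrib]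
  congr 2
  refine Finset.sum_congr rfl fun i _ => ?_
  rw [← mul_add, add_comm, Complex.re_add_im]

end Tube

/-! ### Isolating a frequency by averaging -/

section Mean

variable {ι G V : Type*} [NormedAddCommGroup V] [NormedSpace ℂ V]

/-- A multiplier `b` on the frequencies `χ i` is averaging if it fixes the frequency `χ i₀` and
does not increase the sup norm of any absolutely convergent series. -/
structure IsAveraging (χ : ι → G → ℂ) (i₀ : ι) (b : ι → ℂ) : Prop where
  norm_le : ∀ i, ‖b i‖ ≤ 1
  eq_one : ∀ i, χ i = χ i₀ → b i = 1
  bound : ∀ (a : ι → V) (B : ℝ), Summable (fun i => ‖a i‖) → (∀ g, ‖∑' i, χ i g • a i‖ ≤ B) →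
    ∀ g, ‖∑' i, χ i g • b i • a i‖ ≤ B

variable {χ : ι → G → ℂ} {i₀ : ι}

theorem IsAveraging.one : IsAveraging (V := V) χ i₀ 1 :=
  ⟨fun _ => by simp, fun _ _ => rfl, fun a B _ h => by simpa using h⟩

theorem IsAveraging.mul {b b' : ι → ℂ} (hb : IsAveraging (V := V) χ i₀ b)
    (hb' : IsAveraging (V := V) χ i₀ b') : IsAveraging (V := V) χ i₀ (b * b') := by
  refine ⟨fun i => ?_, fun i hi => ?_, fun a B ha h => ?_⟩
  · simpa using mul_le_one₀ (hb.norm_le i) (norm_nonneg _) (hb'.norm_le i)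
  · simp [hb.eq_one i hi, hb'.eq_one i hi]
  · simp only [Pi.mul_apply, mul_smul]
    refine hb.bound _ B ?_ (hb'.bound a B ha h)
    refine Summable.of_nonneg_of_le (fun _ => norm_nonneg _) (fun i => ?_) ha
    rw [norm_smul]
    exact mul_le_of_le_one_left (norm_nonneg _) (hb'.norm_le i)

theorem IsAveraging.pow {b : ι → ℂ} (hb : IsAveraging (V := V) χ i₀ b) (n : ℕ) :
    IsAveraging (V := V) χ i₀ (b ^ n) := by
  induction n with
  | zero => simpa using IsAveraging.one
  | succ n ih => rw [pow_succ]; exact ih.mul hb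

variable [CompleteSpace V]

theorem summable_unit_smul {c : ι → ℂ} (hc : ∀ i, ‖c i‖ ≤ 1) {a : ι → V}
    (ha : Summable fun i => ‖a i‖) : Summable fun i => c i • a i :=
  Summable.of_norm_bounded ha fun i => by
    rw [norm_smul]
    exact mul_le_of_le_one_left (norm_nonneg _) (hc i)

variable [AddGroup G]

/-- The multiplier comes from averaging a series with its translate by `h`, renormalised so that the
frequency `χ i₀` is unchanged. -/
theorem IsAveraging.shift (hχ : ∀ i g, ‖χ i g‖ = 1) (hadd : ∀ i g h, χ i (g + h) = χ i g * χ i h)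
    (h : G) : IsAveraging (V := V) χ i₀ fun i => (1 + (χ i₀ h)⁻¹ * χ i h) / 2 := by
  have h0 : ∀ i g, χ i g ≠ 0 := fun i g => norm_ne_zero_iff.1 (by rw [hχ]; exact one_ne_zero)
  refine ⟨fun i => ?_, fun i hi => ?_, fun a B ha hB g => ?_⟩
  · have : ‖1 + (χ i₀ h)⁻¹ * χ i h‖ ≤ 1 + 1 := (norm_add_le _ _).trans (by simp [hχ])
    rw [norm_div]
    simp only [Complex.norm_ofNat]
    linarith
  · rw [hi, inv_mul_cancel₀ (h0 _ _)]
    norm_num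
  · have hs : ∀ g, Summable fun i => χ i g • a i := fun g =>
      summable_unit_smul (fun i => (hχ i g).le) ha
    have : ∑' i, χ i g • ((1 + (χ i₀ h)⁻¹ * χ i h) / 2) • a i =
        (2 : ℂ)⁻¹ • ((∑' i, χ i g • a i) + (χ i₀ h)⁻¹ • ∑' i, χ i (g + h) • a i) := by
      rw [← (hs _).tsum_const_smul, ← (hs _).tsum_add ((hs _).const_smul _),
        ← ((hs _).add ((hs _).const_smul _)).tsum_const_smul]
      refine tsum_congr fun i => ?_
      rw [hadd]
      module
    rw [this, norm_smul]
    have h1 := hB g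
    have h2 : ‖(χ i₀ h)⁻¹ • ∑' i, χ i (g + h) • a i‖ ≤ B := by
      rw [norm_smul, norm_inv, hχ]
      simpa using hB (g + h)
    have := norm_add_le (∑' i, χ i g • a i) ((χ i₀ h)⁻¹ • ∑' i, χ i (g + h) • a i)
    simp only [norm_inv, Complex.norm_ofNat]
    linarith

theorem norm_one_add_lt {x : ℂ} (hx : ‖x‖ = 1) (hx1 : x ≠ 1) : ‖(1 + x) / 2‖ < 1 := by
  have : ‖1 + x‖ < ‖(1 : ℂ)‖ + ‖x‖ := by
    refine norm_add_lt_of_not_sameRay fun h => hx1 ?_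
    exact ((sameRay_iff_of_norm_eq (by simp [hx])).1 h).symm
  rw [norm_div]
  simp only [norm_one, hx, Complex.norm_ofNat] at this ⊢
  linarith

/-- A frequency other than `χ i₀` differs from it at some `h`. The strict triangle inequality makes
the multiplier of that shift smaller than one in norm, and a high power makes it small. Multiplying
such powers handles a finite set of frequencies. -/
theorem IsAveraging.exists_small (hχ : ∀ i g, ‖χ i g‖ = 1)
    (hadd : ∀ i g h, χ i (g + h) = χ i g * χ i h) {ε : ℝ} (hε : 0 < ε) (s : Finset ι) :
    ∃ b, IsAveraging (V := V) χ i₀ b ∧ ∀ i ∈ s, χ i ≠ χ i₀ → ‖b i‖ ≤ ε := by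
  classical
  induction s using Finset.induction_on with
  | empty => exact ⟨1, IsAveraging.one, by simp⟩
  | insert j s _ ih =>
    obtain ⟨b, hb, hbs⟩ := ih
    by_cases hj : χ j = χ i₀
    · refine ⟨b, hb, fun i hi hne => ?_⟩
      rcases Finset.mem_insert.1 hi with rfl | hi
      · exact absurd hj hne
      · exact hbs i hi hne
    · obtain ⟨h, hh⟩ := Function.ne_iff.1 hj
      have h0 : χ i₀ h ≠ 0 := norm_ne_zero_iff.1 (by rw [hχ]; exact one_ne_zero)
      have hlt : ‖(1 + (χ i₀ h)⁻¹ * χ j h) / 2‖ < 1 :=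
        norm_one_add_lt (by simp [hχ]) fun h1 => hh (inv_mul_eq_one₀ h0 |>.1 h1).symm
      obtain ⟨n, hn⟩ := exists_pow_lt_of_lt_one hε hlt
      have hc := (IsAveraging.shift (V := V) (i₀ := i₀) hχ hadd h).pow n
      refine ⟨_, hb.mul hc, fun i hi hne => ?_⟩
      rw [Pi.mul_apply, norm_mul]
      rcases Finset.mem_insert.1 hi with rfl | hi
      · refine (mul_le_of_le_one_left (norm_nonneg _) (hb.norm_le _)).trans ?_
        simpa only [Pi.pow_apply, norm_pow] using hn.le
      · exact (mul_le_of_le_one_right (norm_nonneg _) (hc.norm_le _)).trans (hbs i hi hne)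

/-- The part of an absolutely convergent trigonometric series at a given frequency is bounded by
any bound of the series. -/
theorem norm_tsum_frequency_le (hχ : ∀ i g, ‖χ i g‖ = 1)
    (hadd : ∀ i g h, χ i (g + h) = χ i g * χ i h) {a : ι → V} (ha : Summable fun i => ‖a i‖)
    {B : ℝ} (hB : ∀ g, ‖∑' i, χ i g • a i‖ ≤ B) (i₀ : ι) :
    ‖∑' i, {i | χ i = χ i₀}.indicator a i‖ ≤ B := by
  classical
  have hz : ∀ i, χ i 0 = 1 := fun i => by
    have h0 : χ i 0 ≠ 0 := norm_ne_zero_iff.1 (by rw [hχ]; exact one_ne_zero)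
    have := hadd i 0 0
    rw [add_zero] at this
    exact (mul_eq_left₀ h0).1 this.symm
  set A := ∑' i, ‖a i‖ with hA
  have hA0 : 0 ≤ A := tsum_nonneg fun _ => norm_nonneg _
  refine le_of_forall_pos_le_add fun ε hε => ?_
  obtain ⟨s, hs⟩ : ∃ s : Finset ι, ∑' i, ‖a i‖ - ∑ i ∈ s, ‖a i‖ < ε / 2 := by
    have := ha.hasSum.eventually (lt_mem_nhds (sub_lt_self (∑' i, ‖a i‖) (half_pos hε)))
    obtain ⟨s, hs⟩ := this.exists
    exact ⟨s, by linarith⟩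
  have hδ : 0 < ε / 2 / (A + 1) := by positivity
  obtain ⟨b, hb, hbs⟩ := IsAveraging.exists_small (V := V) (i₀ := i₀) hχ hadd hδ s
  have h1 := hb.bound a B ha hB 0
  simp only [hz, one_smul] at h1
  set c := {i | χ i = χ i₀}.indicator a with hc
  have hcn : ∀ i, ‖c i‖ ≤ ‖a i‖ := fun i => norm_indicator_le_norm_self _ _
  have hcs : Summable fun i => ‖c i‖ := Summable.of_nonneg_of_le (fun _ => norm_nonneg _) hcn ha
  have hbs' : Summable fun i => b i • a i := summable_unit_smul hb.norm_le ha
  -- On the finite set `s` the wrong frequencies are damped by the small factor; outside `s` the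
  -- tail of `∑ ‖a i‖` absorbs them.
  have hpt : ∀ i, ‖c i - b i • a i‖ ≤
      ε / 2 / (A + 1) * ‖a i‖ + (‖a i‖ - (s : Set ι).indicator (fun i => ‖a i‖) i) := by
    intro i
    have h2 : (0 : ℝ) ≤ ε / 2 / (A + 1) * ‖a i‖ := by positivity
    by_cases hi : χ i = χ i₀
    · have : c i = a i := indicator_of_mem (s := {i | χ i = χ i₀}) hi a
      rw [this, hb.eq_one i hi, one_smul, sub_self, norm_zero]
      have := indicator_le_self' (s := (s : Set ι)) (f := fun i => ‖a i‖)
        (fun _ _ => norm_nonneg _) i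
      simp only at this
      linarith
    · have : c i = 0 := indicator_of_notMem (s := {i | χ i = χ i₀}) hi a
      rw [this, zero_sub, norm_neg, norm_smul]
      by_cases his : i ∈ s
      · rw [indicator_of_mem (Finset.mem_coe.2 his), sub_self, add_zero]
        exact mul_le_mul_of_nonneg_right (hbs i his hi) (norm_nonneg _)
      · rw [indicator_of_notMem (by simpa using his), sub_zero]
        have := mul_le_of_le_one_left (norm_nonneg (a i)) (hb.norm_le i)
        linarith
  have hsi : HasSum ((s : Set ι).indicator fun i => ‖a i‖) (∑ i ∈ s, ‖a i‖) := by
    rw [← hasSum_subtype_iff_indicator]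
    exact s.hasSum _
  have hsum := (ha.hasSum.mul_left (ε / 2 / (A + 1))).add (ha.hasSum.sub hsi)
  have h3 : ‖∑' i, (c i - b i • a i)‖ ≤ ε / 2 / (A + 1) * A + (A - ∑ i ∈ s, ‖a i‖) :=
    tsum_of_norm_bounded hsum hpt
  rw [hcs.of_norm.tsum_sub hbs'] at h3
  have h4 : ε / 2 / (A + 1) * A ≤ ε / 2 := by
    rw [div_mul_eq_mul_div, div_le_iff₀ (by positivity)]
    nlinarith
  have h5 := norm_sub_norm_le (∑' i, c i) (∑' i, b i • a i)
  linarith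

theorem norm_coeff_le_of_injective (hχ : ∀ i g, ‖χ i g‖ = 1)
    (hadd : ∀ i g h, χ i (g + h) = χ i g * χ i h) {a : ι → V} (ha : Summable fun i => ‖a i‖)
    {B : ℝ} (hB : ∀ g, ‖∑' i, χ i g • a i‖ ≤ B) (i₀ : ι) (hi : ∀ i, a i ≠ 0 → χ i = χ i₀ → i = i₀) :
    ‖a i₀‖ ≤ B := by
  have h := norm_tsum_frequency_le hχ hadd ha hB i₀
  have hm : i₀ ∈ {i | χ i = χ i₀} := rfl
  have h0 : ∀ i, i ≠ i₀ → {i | χ i = χ i₀}.indicator a i = 0 := by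
    intro i hne
    by_cases hai : a i = 0
    · simp [indicator, hai]
    · have hi' : i ∉ {i | χ i = χ i₀} := fun hi' => hne (hi i hai hi')
      exact indicator_of_notMem hi' a
  rwa [tsum_eq_single i₀ h0, indicator_of_mem hm] at h

end Mean

theorem e_half : e (1 / 2) = -1 := by
  rw [e, ← Complex.exp_pi_mul_I]
  congr 1
  ring

theorem e_half_ne_one : e (1 / 2) ≠ 1 := by
  rw [e_half]
  norm_num

/-! ### Uniqueness of the Fourier expansion and vanishing for negative `m` -/

section Expansion

variable {N : ℕ} {V : Type*} [NormedAddCommGroup V] [NormedSpace ℂ V]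

/-- The point `u + i v` of the upper half plane. -/
def mkH (u : ℝ) {v : ℝ} (hv : 0 < v) : ℍ := ⟨u + v * Complex.I, by simpa using hv⟩

@[simp] theorem coe_mkH (u : ℝ) {v : ℝ} (hv : 0 < v) : (mkH u hv : ℂ) = u + v * Complex.I := rfl

@[simp] theorem im_mkH (u : ℝ) {v : ℝ} (hv : 0 < v) : (mkH u hv).im = v := by
  rw [← UpperHalfPlane.coe_im, coe_mkH]
  simp

variable {φ φ' : ℍ → (Fin N → ℂ) → V} {c c' : ℝ → (Fin N → ℚ) → V}

theorem IsFourierExpansion.sub (h : IsFourierExpansion φ c) (h' : IsFourierExpansion φ' c') :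
    IsFourierExpansion (φ - φ') (c - c') := fun τ z => by
  simpa only [Pi.sub_apply, smul_sub] using (h τ z).sub (h' τ z)

theorem IsFourierExpansion.summable_norm [FiniteDimensional ℂ V] (h : IsFourierExpansion φ c)
    (τ : ℍ) (z : Fin N → ℂ) : Summable fun p : ℝ × (Fin N → ℚ) =>
      ‖(e (p.1 * τ) * e ((fun i => (p.2 i : ℂ)) ⬝ᵥ z)) • c p.1 p.2‖ :=
  (h τ z).summable.norm

/-- If `r` and `r'` differ at `i`, the rational vector supported at `i` with entry `1 / (2 (r i - r'
i))` makes the two characters differ by `e(1/2) = -1`. -/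
theorem e_ratCast_dotProduct_injective {r r' : Fin N → ℚ}
    (h : ∀ β : Fin N → ℚ, e ((fun i => (r i : ℂ)) ⬝ᵥ fun i => (β i : ℂ)) =
      e ((fun i => (r' i : ℂ)) ⬝ᵥ fun i => (β i : ℂ))) : r = r' := by
  by_contra hne
  obtain ⟨i, hi⟩ := Function.ne_iff.1 hne
  have hd : r i - r' i ≠ 0 := sub_ne_zero.2 hi
  have h1 := h (Pi.single i (1 / (2 * (r i - r' i))))
  have hs : ∀ x : ℚ, (fun j => ((Pi.single i x : Fin N → ℚ) j : ℂ)) = Pi.single i (x : ℂ) := by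
    intro x
    ext j
    rcases eq_or_ne j i with rfl | hj
    · simp
    · simp [hj]
  rw [hs, dotProduct_single, dotProduct_single] at h1
  refine e_half_ne_one ?_
  have h2 : (1 / 2 : ℂ) = (r i : ℂ) * ((1 / (2 * (r i - r' i)) : ℚ) : ℂ) +
      -((r' i : ℂ) * ((1 / (2 * (r i - r' i)) : ℚ) : ℂ)) := by
    rw [← sub_eq_add_neg, ← sub_mul]
    have : ((r i : ℂ) - r' i) ≠ 0 := by exact_mod_cast hd
    push_cast
    field_simp
  rw [h2, e_add, e_neg, h1, mul_inv_cancel₀ (e_ne_zero _)]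

theorem e_ofReal_mul_injective {m m' : ℝ} (h : ∀ u : ℝ, e (m * u) = e (m' * u)) : m = m' := by
  by_contra hne
  have hd : m - m' ≠ 0 := sub_ne_zero.2 hne
  have h1 := h (1 / (2 * (m - m')))
  refine e_half_ne_one ?_
  have h2 : (1 / 2 : ℂ) = (m : ℂ) * ((1 / (2 * (m - m')) : ℝ) : ℂ) +
      -((m' : ℂ) * ((1 / (2 * (m - m')) : ℝ) : ℂ)) := by
    rw [← sub_eq_add_neg, ← sub_mul]
    have : ((m : ℂ) - m') ≠ 0 := by exact_mod_cast hd
    push_cast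
    field_simp
  rw [h2, e_add, e_neg, h1, mul_inv_cancel₀ (e_ne_zero _)]

theorem dotProduct_ratCast (r β : Fin N → ℚ) :
    ((fun i => (r i : ℂ)) ⬝ᵥ fun i => (β i : ℂ)) = ((r ⬝ᵥ β : ℚ) : ℂ) := by
  simp [dotProduct]

theorem norm_e_ratCast (x : ℚ) : ‖e (x : ℂ)‖ = 1 := by
  simpa using norm_e_ofReal x

theorem e_ofReal_mul_add (m u v : ℝ) :
    e (m * (u + v * Complex.I)) = e (m * u) * e (m * (v * Complex.I)) := by
  rw [mul_add, e_add]

variable [FiniteDimensional ℂ V]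

/-- If `φ(τ, β)` is bounded as `Im τ → ∞` for all rational `β`, then the coefficients `c(m, r)` with
`m < 0` vanish. -/
theorem IsFourierExpansion.eq_zero_of_neg (h : IsFourierExpansion φ c)
    (hb : ∀ β : Fin N → ℚ, IsBoundedAtImInfty fun τ => φ τ fun i => (β i : ℂ))
    {m : ℝ} (hm : m < 0) (r : Fin N → ℚ) : c m r = 0 := by
  have : CompleteSpace V := FiniteDimensional.complete ℂ V
  have hc : ∀ v : ℝ, 0 < v → ∀ β : Fin N → ℚ, Summable fun p : ℝ × (Fin N → ℚ) =>
      ‖(e (p.1 * (v * Complex.I)) * e ((fun i => (p.2 i : ℂ)) ⬝ᵥ fun i => (β i : ℂ))) •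
        c p.1 p.2‖ := by
    intro v hv β
    simpa using h.summable_norm (mkH 0 hv) fun i => (β i : ℂ)
  let b : ℝ × (Fin N → ℚ) → V := {p : ℝ × (Fin N → ℚ) | p.1 = m}.indicator fun p => c p.1 p.2
  have hb1 : ∀ p : ℝ × (Fin N → ℚ), p.1 = m → b p = c p.1 p.2 := fun p hp =>
    indicator_of_mem (s := {p : ℝ × (Fin N → ℚ) | p.1 = m}) hp _
  have hb0 : ∀ p : ℝ × (Fin N → ℚ), p.1 ≠ m → b p = 0 := fun p hp =>
    indicator_of_notMem (s := {p : ℝ × (Fin N → ℚ) | p.1 = m}) hp _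
  have hbs : Summable fun p => ‖b p‖ := by
    have h1 := (hc 1 one_pos 0).mul_left ‖e (m * Complex.I)‖⁻¹
    refine Summable.of_nonneg_of_le (fun _ => norm_nonneg _) (fun p => ?_) h1
    by_cases hp : p.1 = m
    · rw [hb1 p hp, hp, norm_smul, norm_mul, dotProduct_ratCast, norm_e_ratCast, mul_one]
      simp only [Complex.ofReal_one, one_mul]
      rw [inv_mul_cancel_left₀ (norm_ne_zero_iff.2 (e_ne_zero _))]
    · rw [hb0 p hp, norm_zero]
      positivity
  have key : ∀ β : Fin N → ℚ,
      ∑' p, e ((fun i => (p.2 i : ℂ)) ⬝ᵥ fun i => (β i : ℂ)) • b p = 0 := by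
    intro β
    obtain ⟨K, A, hKA⟩ := isBoundedAtImInfty_iff.1 (hb β)
    by_contra hne
    -- Averaging over the real part of `τ` isolates the power `q^m`. The bound `K` does not depend
    -- on `v`, whereas for `m < 0` the exponential grows with `v`.
    have hle : ∀ v : ℝ, 0 < v → A ≤ v → Real.exp (-2 * Real.pi * m * v) *
        ‖∑' p, e ((fun i => (p.2 i : ℂ)) ⬝ᵥ fun i => (β i : ℂ)) • b p‖ ≤ K := by
      intro v hv hAv
      have h1 := norm_tsum_frequency_le (G := ℝ) (χ := fun (p : ℝ × (Fin N → ℚ)) u => e (p.1 * u))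
        (fun p u => by rw [← Complex.ofReal_mul, norm_e_ofReal])
        (fun p u w => by push_cast; rw [mul_add, e_add]) (hc v hv β) (B := K) (fun u => ?_) (m, 0)
      · refine le_trans (le_of_eq ?_) h1
        rw [show Real.exp (-2 * Real.pi * m * v) = ‖e (m * (v * Complex.I))‖ by
          rw [norm_e]; congr 1; simp; ring, ← norm_smul]
        congr 1
        have hs : Summable fun p => e ((fun i => (p.2 i : ℂ)) ⬝ᵥ fun i => (β i : ℂ)) • b p :=
          summable_unit_smul (fun p => by rw [dotProduct_ratCast, norm_e_ratCast]) hbs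
        rw [← hs.tsum_const_smul]
        refine tsum_congr fun p => ?_
        by_cases hp : p.1 = m
        · have hp' : p ∈ {p : ℝ × (Fin N → ℚ) | (fun u : ℝ => e (p.1 * u)) =
              fun u : ℝ => e ((m, (0 : Fin N → ℚ)).1 * u)} := by
            change _ = _
            simp [hp]
          rw [indicator_of_mem hp', hb1 p hp, smul_smul, hp]
        · have hp' : p ∉ {p : ℝ × (Fin N → ℚ) | (fun u : ℝ => e (p.1 * u)) =
              fun u : ℝ => e ((m, (0 : Fin N → ℚ)).1 * u)} :=
            fun hp' => hp (e_ofReal_mul_injective fun u => congrFun hp' u)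
          rw [indicator_of_notMem hp', hb0 p hp, smul_zero, smul_zero]
      · have h2 := (h (mkH u hv) fun i => (β i : ℂ)).tsum_eq
        have h3 := hKA (mkH u hv) (by simpa using hAv)
        refine le_trans (le_of_eq ?_) h3
        rw [← h2]
        congr 1
        refine tsum_congr fun p => ?_
        rw [coe_mkH, e_ofReal_mul_add, smul_smul, mul_assoc]
    have hlim : Tendsto (fun v : ℝ => Real.exp (-2 * Real.pi * m * v) *
        ‖∑' p, e ((fun i => (p.2 i : ℂ)) ⬝ᵥ fun i => (β i : ℂ)) • b p‖) atTop atTop := by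
      refine Tendsto.atTop_mul_const (norm_pos_iff.2 hne) (Real.tendsto_exp_atTop.comp ?_)
      refine tendsto_id.const_mul_atTop ?_
      have := Real.pi_pos
      nlinarith [mul_pos this (neg_pos.2 hm)]
    obtain ⟨v, hv⟩ := ((hlim.eventually_gt_atTop K).and
      ((eventually_gt_atTop 0).and (eventually_ge_atTop A))).exists
    exact absurd (hle v hv.2.1 hv.2.2) (not_le.2 hv.1)
  -- The bound is known only at rational `β`, so the second average runs over `ℚᴺ`; its characters
  -- still separate the frequencies `r`.
  have h1 := norm_coeff_le_of_injective (G := Fin N → ℚ)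
    (χ := fun (p : ℝ × (Fin N → ℚ)) β => e ((fun i => (p.2 i : ℂ)) ⬝ᵥ fun i => (β i : ℂ)))
    (fun p β => by rw [dotProduct_ratCast, norm_e_ratCast])
    (fun p β γ => by
      simp only [dotProduct_ratCast]
      rw [dotProduct_add, Rat.cast_add, e_add]) hbs (B := 0) (fun β => by rw [key, norm_zero]) (m, r)
    fun p hp hp' => Prod.ext (not_imp_comm.1 (hb0 p) hp)
      (e_ratCast_dotProduct_injective fun β => congrFun hp' β)
  rw [hb1 _ rfl] at h1
  exact norm_le_zero_iff.1 h1

/-- Along `Im τ = 1` and real `z` the expansion is a trigonometric series on `ℝ × ℝᴺ` with distinct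
frequencies `(m, r)` and sum zero. -/
theorem IsFourierExpansion.eq_zero_of_eq_zero (h : IsFourierExpansion (0 : ℍ → (Fin N → ℂ) → V) c) :
    c = 0 := by
  have : CompleteSpace V := FiniteDimensional.complete ℂ V
  ext m r
  have hr : ∀ (r : Fin N → ℚ) (x : Fin N → ℝ), ((fun i => (r i : ℂ)) ⬝ᵥ fun i => (x i : ℂ)) =
      ((∑ i, (r i : ℝ) * x i : ℝ) : ℂ) := fun r x => by simp [dotProduct]
  have hχ := norm_coeff_le_of_injective (G := ℝ × (Fin N → ℝ))
    (χ := fun (p : ℝ × (Fin N → ℚ)) g => e (p.1 * g.1) * e ((fun i => (p.2 i : ℂ)) ⬝ᵥ fun i => (g.2 i : ℂ)))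
    (fun p g => by rw [hr, norm_mul, ← Complex.ofReal_mul, norm_e_ofReal, norm_e_ofReal, one_mul])
    (fun p g g' => by
      simp only [hr, ← e_add, ← Complex.ofReal_mul, ← Complex.ofReal_add]
      congr 2
      simp only [Prod.fst_add, Prod.snd_add, Pi.add_apply, mul_add, Finset.sum_add_distrib]
      ring)
    (h.summable_norm (mkH 0 one_pos) 0) (B := 0) (fun g => by
      have h1 := (h (mkH g.1 one_pos) fun i => (g.2 i : ℂ)).tsum_eq
      refine le_of_eq (norm_eq_zero.2 (Eq.trans ?_ h1))
      refine tsum_congr fun p => ?_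
      rw [smul_smul]
      congr 1
      simp only [coe_mkH, e_ofReal_mul_add, dotProduct_zero, e_zero]
      simp [e_zero]
      ring) (m, r)
    (fun p _ hp' => Prod.ext (e_ofReal_mul_injective fun u => by
        have := congrFun hp' (u, 0)
        have h0 : (fun i => (((0 : Fin N → ℝ) i : ℝ) : ℂ)) = 0 := by ext; simp
        simpa [h0, e_zero] using this) (e_ratCast_dotProduct_injective fun β => by
        have := congrFun hp' (0, fun i => (β i : ℝ))
        simpa [e_zero] using this))
  exact (smul_eq_zero.1 (norm_le_zero_iff.1 hχ)).resolve_left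
    (mul_ne_zero (e_ne_zero _) (e_ne_zero _))

theorem IsFourierExpansion.unique (h : IsFourierExpansion φ c) (h' : IsFourierExpansion φ c') :
    c = c' := by
  have := h.sub h'
  rw [sub_self] at this
  exact sub_eq_zero.1 this.eq_zero_of_eq_zero

end Expansion

/-! ### Unitary operators and their orders -/

section LinearAlgebra

variable {V : Type*} [NormedAddCommGroup V] [InnerProductSpace ℂ V]

theorem injective_of_inner_map {f : V →ₗ[ℂ] V} (hf : ∀ v w, inner ℂ (f v) (f w) = inner ℂ v w) :
    Function.Injective f := by
  refine (injective_iff_map_eq_zero f).2 fun v hv => ?_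
  rw [← inner_self_eq_zero (𝕜 := ℂ), ← hf, hv, inner_zero_left]

theorem norm_map_of_inner_map {f : V →ₗ[ℂ] V} (hf : ∀ v w, inner ℂ (f v) (f w) = inner ℂ v w)
    (v : V) : ‖f v‖ = ‖v‖ := by
  rw [@norm_eq_sqrt_re_inner ℂ, hf, ← @norm_eq_sqrt_re_inner ℂ]

variable [FiniteDimensional ℂ V]

/-- The orthogonal complement of an invariant subspace is invariant, since an isometry maps a finite
dimensional invariant subspace onto itself. So `f` is semisimple, and over `ℂ` its eigenvectors
span. -/
theorem iSup_eigenspace_of_inner_map {f : Module.End ℂ V}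
    (hf : ∀ v w, inner ℂ (f v) (f w) = inner ℂ v w) : ⨆ μ, f.eigenspace μ = ⊤ := by
  refine Module.End.IsSemisimple.iSup_eigenspace_eq_top (Module.End.isSemisimple_iff.2 ?_)
  intro p hp
  refine ⟨pᗮ, fun x hx => ?_, Submodule.isCompl_orthogonal p⟩
  rw [Submodule.mem_comap, Submodule.mem_orthogonal]
  have hp' : ∀ y ∈ p, f y ∈ p := fun y hy => hp hy
  have hsurj : Function.Surjective (f.restrict hp') :=
    LinearMap.surjective_of_injective fun a b hab =>
      Subtype.ext (injective_of_inner_map hf (congrArg Subtype.val hab))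
  intro y hy
  obtain ⟨y', hy'⟩ := hsurj ⟨y, hy⟩
  have : f y' = y := congrArg Subtype.val hy'
  rw [← this, hf]
  exact (Submodule.mem_orthogonal _ _).1 hx _ y'.2

theorem exists_eigenbasis_of_inner_map {f : Module.End ℂ V}
    (hf : ∀ v w, inner ℂ (f v) (f w) = inner ℂ v w) :
    ∃ (κ : Set V) (_ : Fintype κ) (b : Module.Basis κ ℂ V) (t : κ → ℝ),
      ∀ x j, b.repr (f x) j = e (t j) * b.repr x j := by
  have hspan : ⊤ ≤ Submodule.span ℂ {v : V | ∃ μ : ℂ, f v = μ • v} := by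
    rw [← iSup_eigenspace_of_inner_map hf, iSup_le_iff]
    exact fun μ v hv => Submodule.subset_span ⟨μ, Module.End.mem_eigenspace_iff.1 hv⟩
  let b := Module.Basis.ofSpan hspan
  have hb : ∀ j, ∃ μ : ℂ, f (b j) = μ • b j := fun j =>
    Module.Basis.ofSpan_subset hspan (mem_range_self j)
  choose μ hμ using hb
  have hμ1 : ∀ j, ‖μ j‖ = 1 := by
    intro j
    have := norm_map_of_inner_map hf (b j)
    rw [hμ, norm_smul] at this
    exact (mul_eq_right₀ (norm_ne_zero_iff.2 (b.ne_zero j))).1 this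
  choose t ht using fun j => exists_e_eq (hμ1 j)
  have : Fintype _ := FiniteDimensional.fintypeBasisIndex b
  refine ⟨_, this, b, t, fun x j => ?_⟩
  have key : b.coord j ∘ₗ f = e (t j) • b.coord j := by
    refine b.ext fun i => ?_
    simp only [LinearMap.comp_apply, hμ, map_smul, LinearMap.smul_apply, smul_eq_mul, ht]
    rcases eq_or_ne i j with rfl | hij
    · rfl
    · simp [Module.Basis.coord_apply, hij]
  exact LinearMap.congr_fun key x

/-- If `A`, `T` commute with the unitary operator `B` up to the relation `A T = T A Bᴷ`, then `B` has
finite order. -/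
theorem exists_pow_eq_one_of_inner_map {A B T : Module.End ℂ V} {K : ℕ} (hK : 0 < K)
    (hA : Function.Injective A) (hT : Function.Injective T)
    (hB : ∀ v w, inner ℂ (B v) (B w) = inner ℂ v w) (hAB : A * B = B * A) (hTB : T * B = B * T)
    (hAT : A * T = T * A * B ^ K) : ∃ L : ℕ, 0 < L ∧ B ^ L = 1 := by
  -- An eigenvalue `β` with eigenspace of dimension `d` will satisfy `β ^ (K d) = 1`, and every such
  -- `d` divides the factorial of the dimension of `V`.
  refine ⟨K * (Module.finrank ℂ V).factorial, by positivity, ?_⟩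
  rw [← sub_eq_zero, ← LinearMap.ker_eq_top, ← top_le_iff, ← iSup_eigenspace_of_inner_map hB,
    iSup_le_iff]
  intro β
  have hBE : ∀ x ∈ B.eigenspace β, ∀ n : ℕ, (B ^ n) x = β ^ n • x := by
    intro x hx n
    induction n with
    | zero => simp
    | succ n ih =>
      rw [pow_succ, Module.End.mul_apply, Module.End.mem_eigenspace_iff.1 hx, map_smul, ih, smul_smul,
        pow_succ']
  rcases eq_or_ne (B.eigenspace β) ⊥ with h0 | hne
  · rw [h0]
    exact bot_le
  have hAE : ∀ x ∈ B.eigenspace β, A x ∈ B.eigenspace β := fun x hx => by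
    rw [Module.End.mem_eigenspace_iff, ← Module.End.mul_apply, ← hAB, Module.End.mul_apply,
      Module.End.mem_eigenspace_iff.1 hx, map_smul]
  have hTE : ∀ x ∈ B.eigenspace β, T x ∈ B.eigenspace β := fun x hx => by
    rw [Module.End.mem_eigenspace_iff, ← Module.End.mul_apply, ← hTB, Module.End.mul_apply,
      Module.End.mem_eigenspace_iff.1 hx, map_smul]
  have hrel : A.restrict hAE * T.restrict hTE = β ^ K • (T.restrict hTE * A.restrict hAE) := by
    ext x
    have := LinearMap.congr_fun hAT (x : V)
    simp only [Module.End.mul_apply] at this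
    rw [hBE x x.2, map_smul, map_smul] at this
    simpa using this
  have hdet : ∀ (C : Module.End ℂ V) (hCE : ∀ x ∈ B.eigenspace β, C x ∈ B.eigenspace β),
      Function.Injective C → LinearMap.det (C.restrict hCE) ≠ 0 := by
    intro C hCE hC h
    have := LinearMap.bot_lt_ker_of_det_eq_zero h
    rw [LinearMap.ker_eq_bot.2 fun a b hab => Subtype.ext (hC (congrArg Subtype.val hab))] at this
    exact lt_irrefl _ this
  -- On the eigenspace the relation is `A T = β ^ K T A`. The nonzero determinants of `A` and `T`
  -- cancel.
  have h1 := congrArg LinearMap.det hrel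
  rw [LinearMap.det_smul, map_mul, map_mul, mul_comm (LinearMap.det (A.restrict hAE))] at h1
  have h2 : (β ^ K) ^ Module.finrank ℂ (B.eigenspace β) = 1 :=
    (mul_eq_right₀ (mul_ne_zero (hdet T hTE hT) (hdet A hAE hA))).1 h1.symm
  have hpos : 0 < Module.finrank ℂ (B.eigenspace β) := by
    rw [Nat.pos_iff_ne_zero, Ne, Submodule.finrank_eq_zero]
    exact hne
  obtain ⟨q, hq⟩ := Nat.dvd_factorial hpos (Submodule.finrank_le (B.eigenspace β))
  intro x hx
  rw [LinearMap.mem_ker, LinearMap.sub_apply, hBE x hx, hq, pow_mul, pow_mul, h2, one_pow, one_smul,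
    Module.End.one_apply, sub_self]

end LinearAlgebra

/-! ### Relations in the Jacobi group -/

namespace JacobiGroup

variable {N : ℕ}

/-- The lift `(T, 1)` of the translation `τ ↦ τ + 1`. -/
def transl (N : ℕ) : JacobiGroup N :=
  { mp := { γ := ModularGroup.T
            ω := fun _ => 1
            holo := mdifferentiable_const
            sq := fun τ => by simp [cd, ModularGroup.T] }
    lam := 0
    mu := 0
    kap := 0 }

theorem heis_mul (l l' m m' : Fin N → ℤ) (k k' : Matrix (Fin N) (Fin N) ℤ) :
    heis l m k * heis l' m' k' = heis (l + l') (m + m')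
      (k + k' + Matrix.vecMulVec l m' - Matrix.vecMulVec m l') := by
  ext i j <;> simp [heis, mul_mp, mul_lam, mul_mu, mul_kap, actL, actR, Matrix.vecMulVec_apply]

theorem heis_zero : heis (0 : Fin N → ℤ) 0 0 = 1 := rfl

theorem heis_mu_add (m m' : Fin N → ℤ) : heis 0 (m + m') 0 = heis 0 m 0 * heis 0 m' 0 := by
  simp [heis_mul]

theorem heis_mu_nsmul (n : ℕ) (m : Fin N → ℤ) : heis 0 (n • m) 0 = heis 0 m 0 ^ n := by
  induction n with
  | zero => simp [heis_zero]
  | succ n ih => rw [succ_nsmul, heis_mu_add, ih, pow_succ]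

theorem heis_lam_mul_heis_mu (l m : Fin N → ℤ) :
    heis l 0 0 * heis 0 m 0 = heis 0 m 0 * heis l 0 0 * heis 0 0 (Matrix.vecMulVec l m + Matrix.vecMulVec m l) := by
  rw [heis_mul, heis_mul, heis_mul]
  ext i j
  · rfl
  · rfl
  · simp [heis]
  · simp [heis]
  · simp [heis, Matrix.vecMulVec_apply]

theorem transl_mul_heis_mu (m : Fin N → ℤ) :
    transl N * heis 0 m 0 = heis 0 m 0 * transl N := by
  ext i j <;> simp [heis, transl, mul_mp, mul_lam, mul_mu, mul_kap, actL, actR, ModularGroup.T,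
    Matrix.vecMulVec_apply]

/-- Conjugating by `T` turns a `λ`-translation into a `λ`-translation times a `μ`-translation, up to
the centre. This is the relation that forces `μ`-translations to have finite order. -/
theorem heis_lam_mul_transl (l : Fin N → ℤ) :
    heis l 0 0 * transl N * heis 0 0 (Matrix.vecMulVec l l) =
      transl N * heis l 0 0 * heis 0 l 0 := by
  ext i j <;> simp [heis, transl, mul_mp, mul_lam, mul_mu, mul_kap, actL, actR, ModularGroup.T,
    Matrix.vecMulVec_apply]

end JacobiGroup

open JacobiGroup

/-! ### Transformation laws and periodicity in `z` -/

section Jacobi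

variable {N : ℕ} {V : Type*} [NormedAddCommGroup V] [NormedSpace ℂ V] {twok : ℤ}
  {M : Matrix (Fin N) (Fin N) ℚ} {ρ : Representation ℂ (JacobiGroup N) V}
  {φ : ℍ → (Fin N → ℂ) → V}

theorem rho_inv_apply (g : JacobiGroup N) (v : V) : ρ g (ρ g⁻¹ v) = v := by
  rw [← Module.End.mul_apply, ← map_mul, mul_inv_cancel, map_one, Module.End.one_apply]

theorem rho_mul_apply (g h : JacobiGroup N) (v : V) : ρ (g * h) v = ρ g (ρ h v) := by
  rw [map_mul, Module.End.mul_apply]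

/-- The transformation law of Jacobi forms, solved for the action of `ρ`. -/
theorem IsJacobiForm.rho_apply (hφ : IsJacobiForm twok M ρ φ) (g : JacobiGroup N) (τ : ℍ)
    (z : Fin N → ℂ) : ρ g (φ τ z) = (g.mp.ω τ ^ (-twok) * expFactor M g τ z) •
      φ (g.mp.γ • τ) (fun i => shift g τ z i / cd g.mp.γ τ) := by
  have h := congrFun (congrFun (hφ.slash_eq g) τ) z
  rw [← h, slash, map_smul, rho_inv_apply]

theorem IsJacobiForm.rho_heis (hφ : IsJacobiForm twok M ρ φ) (l m : Fin N → ℤ)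
    (k : Matrix (Fin N) (Fin N) ℤ) (τ : ℍ) (z : Fin N → ℂ) :
    ρ (heis l m k) (φ τ z) = e ((1 / 2) * (qf (toC M) (fun i => (l i : ℂ)) * τ
      + 2 * ((fun i => (l i : ℂ)) ⬝ᵥ (toC M *ᵥ z))
      + (toC M * (k + Matrix.vecMulVec m l).map (fun n => (n : ℂ))).trace)) •
      φ τ (fun i => z i + l i * τ + m i) := by
  rw [hφ.rho_apply]
  simp [heis, expFactor, shift, cd_one]

theorem IsJacobiForm.rho_heis_mu (hφ : IsJacobiForm twok M ρ φ) (m : Fin N → ℤ) (τ : ℍ)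
    (z : Fin N → ℂ) : ρ (heis 0 m 0) (φ τ z) = φ τ (fun i => z i + m i) := by
  rw [hφ.rho_heis]
  simp [qf, e_zero]

theorem IsJacobiForm.rho_heis_kap (hφ : IsJacobiForm twok M ρ φ) (k : Matrix (Fin N) (Fin N) ℤ)
    (τ : ℍ) (z : Fin N → ℂ) : ρ (heis 0 0 k) (φ τ z) =
      e ((1 / 2) * (toC M * k.map (fun n => (n : ℂ))).trace) • φ τ z := by
  rw [hφ.rho_heis]
  simp [qf]

theorem IsJacobiForm.rho_transl (hφ : IsJacobiForm twok M ρ φ) (τ : ℍ) (z : Fin N → ℂ) :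
    ρ (transl N) (φ τ z) = φ ((1 : ℝ) +ᵥ τ) z := by
  rw [hφ.rho_apply]
  have hs : (transl N).mp.γ • τ = (1 : ℝ) +ᵥ τ := modular_T_smul τ
  have hc : cd ModularGroup.T τ = 1 := by simp [cd, ModularGroup.T]
  have hT : ModularGroup.T 1 0 = 0 := by simp [ModularGroup.T]
  rw [hs]
  simp [transl, expFactor, shift, hc, qf, e_zero, hT]

/-- The span of the values of `φ`. -/
def valueSpan (φ : ℍ → (Fin N → ℂ) → V) : Submodule ℂ V :=
  Submodule.span ℂ (range fun p : ℍ × (Fin N → ℂ) => φ p.1 p.2)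

theorem mem_valueSpan (φ : ℍ → (Fin N → ℂ) → V) (τ : ℍ) (z : Fin N → ℂ) : φ τ z ∈ valueSpan φ :=
  Submodule.subset_span ⟨(τ, z), rfl⟩

theorem IsJacobiForm.rho_mem_valueSpan (hφ : IsJacobiForm twok M ρ φ) (g : JacobiGroup N) :
    ∀ x ∈ valueSpan φ, ρ g x ∈ valueSpan φ := by
  intro x hx
  have : valueSpan φ ≤ (valueSpan φ).comap (ρ g) := by
    refine Submodule.span_le.2 ?_
    rintro _ ⟨⟨τ, z⟩, rfl⟩
    simp only [Submodule.comap_coe, mem_preimage, SetLike.mem_coe]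
    rw [hφ.rho_apply]
    exact Submodule.smul_mem _ _ (mem_valueSpan _ _ _)
  exact this hx

/-- The centre is known to act through the index only on values of `φ`, not on all of `V`; hence the
restriction to their span. -/
theorem IsJacobiForm.rho_heis_kap_valueSpan (hφ : IsJacobiForm twok M ρ φ)
    {k : Matrix (Fin N) (Fin N) ℤ} {n : ℤ}
    (hk : (1 / 2 : ℂ) * (toC M * k.map (fun n => (n : ℂ))).trace = n) :
    ∀ x ∈ valueSpan φ, ρ (heis 0 0 k) x = x := by
  intro x hx
  have : valueSpan φ ≤ LinearMap.eqLocus (ρ (heis 0 0 k)) LinearMap.id := by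
    refine Submodule.span_le.2 ?_
    rintro _ ⟨⟨τ, z⟩, rfl⟩
    change ρ (heis 0 0 k) (φ τ z) = φ τ z
    rw [hφ.rho_heis_kap, hk, e_intCast, one_smul]
  exact this hx

theorem trace_mul_vecMulVec (A : Matrix (Fin N) (Fin N) ℂ) (v w : Fin N → ℂ) :
    (A * Matrix.vecMulVec v w).trace = w ⬝ᵥ (A *ᵥ v) := by
  rw [Matrix.mul_vecMulVec, Matrix.trace_vecMulVec, dotProduct_comm]

section Period

variable {V : Type*} [NormedAddCommGroup V] [InnerProductSpace ℂ V] [FiniteDimensional ℂ V]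
  {ρ : Representation ℂ (JacobiGroup N) V} {φ : ℍ → (Fin N → ℂ) → V}

/-- Translations of `z` by a unit vector act on the values of a Jacobi form with finite order. -/
theorem IsJacobiForm.exists_period_single (hφ : IsJacobiForm twok M ρ φ)
    (hρ : ∀ (g : JacobiGroup N) (v w : V), inner ℂ (ρ g v) (ρ g w) = inner ℂ v w) (i : Fin N) :
    ∃ L : ℕ, 0 < L ∧ ∀ x ∈ valueSpan φ, ρ (heis 0 (L • Pi.single i 1) 0) x = x := by
  -- With `λ = K u` and `μ = u`, the central terms that occur are `2K uuᵗ` and `K² uuᵗ`, both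
  -- multiples of `2 (M i i).den`. They act trivially on the values of `φ`.
  set K : ℕ := 2 * (M i i).den with hK
  have hK0 : 0 < K := by positivity
  have hM : (M i i : ℂ) * (M i i).den = (M i i).num := by
    exact_mod_cast Rat.mul_den_eq_num (M i i)
  set u : Fin N → ℤ := Pi.single i 1 with hu
  let r : JacobiGroup N → Module.End ℂ (valueSpan φ) := fun g =>
    (ρ g).restrict (hφ.rho_mem_valueSpan g)
  have hr : ∀ g h, r (g * h) = r g * r h := fun g h => by
    ext x
    simp [r, LinearMap.restrict_apply]
  have hr1 : r 1 = 1 := by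
    ext x
    simp [r, LinearMap.restrict_apply]
  have hrp : ∀ g n, r (g ^ n) = r g ^ n := fun g n => by
    induction n with
    | zero => simp [hr1]
    | succ n ih => rw [pow_succ, hr, ih, pow_succ]
  have hinner : ∀ g v w, inner ℂ (r g v) (r g w) = inner ℂ v w := fun g v w => hρ g v w
  have htr : ∀ n : ℤ, (toC M * (n • Matrix.vecMulVec u u).map (fun n => (n : ℂ))).trace =
      n * M i i := by
    intro n
    have : (n • Matrix.vecMulVec u u).map (fun n => (n : ℂ)) =
        Matrix.vecMulVec ((n : ℂ) • Pi.single i 1) (Pi.single i 1) := by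
      ext a b
      simp only [Matrix.map_apply, Matrix.smul_apply, Matrix.vecMulVec_apply, hu, smul_eq_mul,
        Pi.smul_apply, Pi.single_apply]
      push_cast
      ring
    rw [this, trace_mul_vecMulVec]
    simp [Matrix.mulVec_smul]
  have hz : ∀ n : ℤ, ∀ q : ℤ, n = 2 * (M i i).den * q → r (heis 0 0 (n • Matrix.vecMulVec u u)) = 1 := by
    intro n q hn
    ext x
    refine hφ.rho_heis_kap_valueSpan (n := (M i i).num * q) ?_ x x.2
    rw [htr, hn]
    push_cast
    linear_combination (q : ℂ) * hM
  have hvv : ∀ a b : ℤ, Matrix.vecMulVec (a • u) (b • u) = (a * b) • Matrix.vecMulVec u u := by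
    intro a b
    ext j k
    simp [Matrix.vecMulVec_apply]
    ring
  obtain ⟨L, hL, hL1⟩ := exists_pow_eq_one_of_inner_map (A := r (heis (K • u) 0 0))
    (B := r (heis 0 u 0)) (T := r (transl N)) hK0 (injective_of_inner_map (hinner _))
    (injective_of_inner_map (hinner _)) (hinner _) (by
      rw [← hr, heis_lam_mul_heis_mu, hr, hr]
      have : Matrix.vecMulVec (K • u) u + Matrix.vecMulVec u (K • u) =
          (2 * K : ℤ) • Matrix.vecMulVec u u := by
        have h1 := hvv K 1
        have h2 := hvv 1 K
        rw [one_smul, natCast_zsmul] at h1 h2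
        rw [h1, h2, ← add_smul]
        congr 1
        ring
      rw [this, hz _ 2 (by push_cast [hK]; ring), mul_one])
    (by rw [← hr, transl_mul_heis_mu, hr]) (by
      have h := congrArg r (heis_lam_mul_transl (K • u))
      have h2 : Matrix.vecMulVec (K • u) (K • u) = (K * K : ℤ) • Matrix.vecMulVec u u := by
        have := hvv K K
        rwa [natCast_zsmul] at this
      rw [h2, hr, hz _ (2 * (M i i).den) (by push_cast [hK]; ring), mul_one, hr, hr, hr,
        heis_mu_nsmul, hrp] at h
      exact h)
  refine ⟨L, hL, fun x hx => ?_⟩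
  rw [heis_mu_nsmul]
  have := congrArg Subtype.val (LinearMap.congr_fun ((hrp (heis 0 u 0) L).trans hL1) ⟨x, hx⟩)
  exact this

theorem IsJacobiForm.exists_period (hφ : IsJacobiForm twok M ρ φ)
    (hρ : ∀ (g : JacobiGroup N) (v w : V), inner ℂ (ρ g v) (ρ g w) = inner ℂ v w) :
    ∃ L : ℕ, 0 < L ∧ ∀ (n : Fin N → ℤ) (τ : ℍ) (z : Fin N → ℂ),
      φ τ (fun i => z i + L * n i) = φ τ z := by
  choose L hL hL1 using hφ.exists_period_single hρ
  -- The periods form a group, so the product of the orders in the coordinate directions serves as a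
  -- common period.
  let Λ : AddSubgroup (Fin N → ℤ) :=
    { carrier := {m | ∀ x ∈ valueSpan φ, ρ (heis 0 m 0) x = x}
      zero_mem' := fun x _ => by simp [heis_zero]
      add_mem' := fun {a b} ha hb x hx => by
        rw [heis_mu_add, rho_mul_apply, hb x hx, ha x hx]
      neg_mem' := fun {a} ha x hx => by
        have h1 := ha x hx
        conv_lhs => rw [← h1]
        rw [← rho_mul_apply, ← heis_mu_add, neg_add_cancel, heis_zero, map_one,
          Module.End.one_apply] }
  refine ⟨∏ i, L i, Finset.prod_pos fun i _ => hL i, fun n τ z => ?_⟩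
  have hmem : (fun i => ((∏ i, L i : ℕ) : ℤ) * n i) ∈ Λ := by
    have : (fun i => ((∏ i, L i : ℕ) : ℤ) * n i) = ∑ i, (((∏ j ∈ Finset.univ.erase i, L j : ℕ) : ℤ) * n i) •
        (L i • (Pi.single i 1 : Fin N → ℤ)) := by
      ext j
      simp only [Finset.sum_apply, Pi.smul_apply, Pi.single_apply]
      rw [Finset.sum_eq_single j]
      · rw [← Finset.mul_prod_erase Finset.univ L (Finset.mem_univ j)]
        push_cast
        simp
        ring
      · intro k _ hk
        simp [hk.symm]
      · simp
    rw [this]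
    exact sum_mem fun i _ => zsmul_mem (show L i • (Pi.single i 1 : Fin N → ℤ) ∈ Λ from hL1 i) _
  have := hmem _ (mem_valueSpan φ τ z)
  rw [hφ.rho_heis_mu] at this
  rw [← this]
  congr 1
  ext i
  push_cast
  ring

end Period

end Jacobi

/-! ### Existence of the Fourier expansion -/

section Existence

variable {N : ℕ}

/-- A scalar function on `ℍ × ℂᴺ` which is holomorphic, `Lℤᴺ`-periodic in `z`, and multiplied by
`e(t)` under `τ ↦ τ + 1` has a Fourier expansion. -/
theorem exists_isFourierExpansion_scalar {f : ℍ → (Fin N → ℂ) → ℂ} {L : ℕ} (hL : 0 < L) {t : ℝ}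
    (hf : DifferentiableOn ℂ (fun p : ℂ × (Fin N → ℂ) => f (ofComplex p.1) p.2) {p | 0 < p.1.im})
    (hτ : ∀ τ z, f ((1 : ℝ) +ᵥ τ) z = e t * f τ z)
    (hz : ∀ (n : Fin N → ℤ) τ z, f τ (fun i => z i + L * n i) = f τ z) :
    ∃ c : ℝ → (Fin N → ℚ) → ℂ, IsFourierExpansion f c := by
  have hL0 : (L : ℂ) ≠ 0 := by exact_mod_cast hL.ne'
  -- The factor `e(-t w₀)` cancels the multiplier of `τ ↦ τ + 1`, and scaling by `L` turns the
  -- period lattice into `ℤᴺ`. Undoing this gives the exponents `m = n₀ + t` and `r = n / L`.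
  let F : (Fin (N + 1) → ℂ) → ℂ := fun w =>
    e (-(t * w 0)) * f (ofComplex (w 0)) fun i => L * w i.succ
  have hU : IsOpen {y : Fin (N + 1) → ℝ | 0 < y 0} :=
    isOpen_lt continuous_const (continuous_apply 0)
  have hUc : Convex ℝ {y : Fin (N + 1) → ℝ | 0 < y 0} :=
    (convex_Ioi (𝕜 := ℝ) (0 : ℝ)).linear_preimage
      (LinearMap.proj (R := ℝ) (φ := fun _ : Fin (N + 1) => ℝ) 0)
  have hF : DifferentiableOn ℂ F {w | (fun i => (w i).im) ∈ {y : Fin (N + 1) → ℝ | 0 < y 0}} := by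
    refine DifferentiableOn.mul (by fun_prop) ?_
    exact hf.comp (f := fun w : Fin (N + 1) → ℂ => (w 0, fun i : Fin N => L * w i.succ))
      (by fun_prop) fun w hw => hw
  have hint : ∀ (n : ℤ) (τ : ℍ) z, f ((n : ℝ) +ᵥ τ) z = e (t * n) * f τ z := by
    intro n
    induction n using Int.induction_on with
    | zero => intro τ z; simp [e_zero]
    | succ n ih =>
      intro τ z
      have h1 : (((n : ℤ) + 1 : ℤ) : ℝ) +ᵥ τ = (1 : ℝ) +ᵥ (((n : ℤ) : ℝ) +ᵥ τ) := by
        rw [vadd_vadd]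
        push_cast
        rw [add_comm]
      rw [h1, hτ, ih, ← mul_assoc, ← e_add]
      congr 2
      push_cast
      ring
    | pred n ih =>
      intro τ z
      have h1 : ((-(n : ℤ) : ℤ) : ℝ) +ᵥ τ = (1 : ℝ) +ᵥ (((-(n : ℤ) - 1 : ℤ) : ℝ) +ᵥ τ) := by
        rw [vadd_vadd]
        push_cast
        congr 1
        ring
      have h2 := ih τ z
      rw [h1, hτ] at h2
      rw [← mul_right_inj' (e_ne_zero t), h2, ← mul_assoc, ← e_add]
      congr 2
      push_cast
      ring
  have hper : ∀ (w : Fin (N + 1) → ℂ) (n : Fin (N + 1) → ℤ),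
      (fun i => (w i).im) ∈ {y : Fin (N + 1) → ℝ | 0 < y 0} → F (fun i => w i + n i) = F w := by
    intro w n hw
    have hw0 : 0 < (w 0).im := hw
    have h1 : ofComplex (w 0 + n 0) = ((n 0 : ℤ) : ℝ) +ᵥ ofComplex (w 0) := by
      ext
      rw [ofComplex_apply_of_im_pos (by simpa using hw0), ofComplex_apply_of_im_pos hw0]
      simp [add_comm]
    simp only [F]
    rw [h1, hint]
    simp only [mul_add]
    rw [hz (fun i => n i.succ), ← mul_assoc, ← e_add]
    congr 2
    ring
  obtain ⟨a, ha⟩ := exists_hasSum_tube hU hUc hF hper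
  let ex : (Fin (N + 1) → ℤ) → ℝ × (Fin N → ℚ) := fun n => (n 0 + t, fun i => n i.succ / L)
  have hex : Function.Injective ex := by
    intro n m h
    have h1 : (n 0 : ℝ) + t = m 0 + t := congrArg Prod.fst h
    have h2 : ∀ i : Fin N, (n i.succ : ℚ) / L = m i.succ / L := fun i =>
      congrFun (congrArg Prod.snd h) i
    have hLq : (L : ℚ) ≠ 0 := by exact_mod_cast hL.ne'
    ext i
    refine Fin.cases ?_ (fun i => ?_) i
    · exact_mod_cast add_right_cancel h1
    · exact_mod_cast (div_left_inj' hLq).1 (h2 i)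
  refine ⟨fun m r => Function.extend ex a 0 (m, r), fun τ z => ?_⟩
  have h := ha (Fin.cons τ fun i => z i / L) (by simpa using τ.im_pos)
  have hFw : F (Fin.cons τ fun i => z i / L) = e (-(t * τ)) * f τ z := by
    simp [F, mul_div_cancel₀ _ hL0]
  rw [hFw] at h
  have h' := h.mul_left (e (t * τ))
  rw [← mul_assoc, ← e_add, add_neg_cancel, e_zero, one_mul] at h'
  refine (hex.hasSum_iff fun p hp => ?_).1 (h'.congr_fun fun n => ?_)
  · change _ • Function.extend ex a 0 p = 0
    rw [Function.extend_apply' _ _ _ hp]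
    simp
  · change _ • Function.extend ex a 0 (ex n) = _
    simp only [hex.extend_apply, smul_eq_mul, ← mul_assoc, ← e_add, ex,
      Fin.sum_univ_succ, Fin.cons_zero, Fin.cons_succ, dotProduct]
    congr 2
    push_cast
    rw [add_mul, add_comm ((n 0 : ℂ) * τ) (t * τ), add_assoc]
    congr 2
    exact Finset.sum_congr rfl fun i _ => by ring

variable {V : Type*} [NormedAddCommGroup V] [InnerProductSpace ℂ V] [FiniteDimensional ℂ V]
  {twok : ℤ} {M : Matrix (Fin N) (Fin N) ℚ} {ρ : Representation ℂ (JacobiGroup N) V}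
  {φ : ℍ → (Fin N → ℂ) → V}

theorem IsJacobiForm.exists_isFourierExpansion (hφ : IsJacobiForm twok M ρ φ)
    (hρ : ∀ (g : JacobiGroup N) (v w : V), inner ℂ (ρ g v) (ρ g w) = inner ℂ v w) :
    ∃ c : ℝ → (Fin N → ℚ) → V, IsFourierExpansion φ c := by
  obtain ⟨L, hL, hper⟩ := hφ.exists_period hρ
  obtain ⟨κ, _, b, t, hb⟩ := exists_eigenbasis_of_inner_map (f := ρ (transl N)) (hρ _)
  have hj : ∀ j, ∃ c : ℝ → (Fin N → ℚ) → ℂ,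
      IsFourierExpansion (fun τ z => b.repr (φ τ z) j) c := by
    intro j
    refine exists_isFourierExpansion_scalar hL (t := t j) ?_ (fun τ z => ?_) fun n τ z => ?_
    · exact (LinearMap.toContinuousLinearMap (b.coord j)).differentiable.comp_differentiableOn
        hφ.holo
    · rw [← hφ.rho_transl, hb]
    · simp only [hper]
  choose c hc using hj
  refine ⟨fun m r => ∑ j, c j m r • b j, fun τ z => ?_⟩
  have h := hasSum_sum fun j (_ : j ∈ Finset.univ) => (hc j τ z).smul_const (b j)
  rw [b.sum_repr] at h
  refine h.congr_fun fun p => ?_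
  rw [Finset.smul_sum]
  exact Finset.sum_congr rfl fun j _ => by rw [smul_assoc]

end Existence

/-! ### The quadratic form and `rd(M)` -/

section QuadraticForm

variable {N : ℕ}

theorem dotProduct_mulVec_symm {R : Type*} [CommRing R] {A : Matrix (Fin N) (Fin N) R} (hA : Aᵀ = A)
    (v w : Fin N → R) : v ⬝ᵥ (A *ᵥ w) = (A *ᵥ v) ⬝ᵥ w := by
  rw [Matrix.dotProduct_mulVec, ← Matrix.mulVec_transpose, hA]

theorem qf_add {R : Type*} [CommRing R] {A : Matrix (Fin N) (Fin N) R} (hA : Aᵀ = A)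
    (v w : Fin N → R) : qf A (v + w) = qf A v + 2 * (v ⬝ᵥ (A *ᵥ w)) + qf A w := by
  have h : w ⬝ᵥ (A *ᵥ v) = v ⬝ᵥ (A *ᵥ w) := by
    rw [dotProduct_mulVec_symm hA, dotProduct_comm]
  simp only [qf, Matrix.mulVec_add, dotProduct_add, add_dotProduct, h]
  ring

theorem qf_neg {R : Type*} [CommRing R] (A : Matrix (Fin N) (Fin N) R) (v : Fin N → R) :
    qf A (-v) = qf A v := by
  simp [qf, Matrix.mulVec_neg]

theorem qf_smul {R : Type*} [CommRing R] (A : Matrix (Fin N) (Fin N) R) (a : R) (v : Fin N → R) :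
    qf A (a • v) = a ^ 2 * qf A v := by
  simp [qf, Matrix.mulVec_smul]
  ring

variable {M : Matrix (Fin N) (Fin N) ℚ}

theorem toR_transpose (hM : (toR M).PosDef) : (toR M)ᵀ = toR M := by
  have := hM.1
  rwa [Matrix.IsHermitian, Matrix.conjTranspose_eq_transpose_of_trivial] at this

theorem transpose_eq_of_posDef (hM : (toR M).PosDef) : Mᵀ = M := by
  have h := toR_transpose hM
  ext i j
  have := congrFun (congrFun h i) j
  simpa using this

theorem toC_transpose (hM : (toR M).PosDef) : (toC M)ᵀ = toC M := by
  ext i j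
  exact congrArg (fun q : ℚ => (q : ℂ)) (congrFun (congrFun (transpose_eq_of_posDef hM) i) j)

theorem qf_toR_nonneg (hM : (toR M).PosDef) (v : Fin N → ℝ) : 0 ≤ qf (toR M) v := by
  have := hM.posSemidef.dotProduct_mulVec_nonneg v
  simpa [qf] using this

@[fun_prop]
theorem continuous_qf_toR : Continuous (qf (toR M)) := by
  unfold qf
  fun_prop

/-- `rd(M)` is at least any common lower bound of the values of `M` on a coset of `ℤᴺ`. -/
theorem le_rd (hM : (toR M).PosDef) {ξ : Fin N → ℝ} {t : ℝ}
    (h : ∀ l : Fin N → ℤ, t ≤ qf (toR M) (ξ + fun i => (l i : ℝ))) : t ≤ rd M := by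
  have hbelow : ∀ ξ : Fin N → ℝ, BddBelow (range fun p : ℤˣ × (Fin N → ℤ) =>
      qf (toR M) (fun i => ((p.1 : ℤ) : ℝ) * ξ i + (p.2 i : ℝ))) := fun ξ =>
    ⟨0, by rintro _ ⟨p, rfl⟩; exact qf_toR_nonneg hM _⟩
  -- A real supremum is a genuine upper bound only for a bounded family. Translation by floors moves
  -- `ξ` into the unit cube, where `M` is bounded.
  have habove : BddAbove (range fun ξ : Fin N → ℝ => ⨅ p : ℤˣ × (Fin N → ℤ),
      qf (toR M) (fun i => ((p.1 : ℤ) : ℝ) * ξ i + (p.2 i : ℝ))) := by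
    obtain ⟨C, hC⟩ := (isCompact_Icc (a := (0 : Fin N → ℝ)) (b := 1)).bddAbove_image
      (f := qf (toR M)) continuous_qf_toR.continuousOn
    refine ⟨C, ?_⟩
    rintro _ ⟨ξ, rfl⟩
    refine (ciInf_le (hbelow ξ) (1, fun i => -⌊ξ i⌋)).trans (hC (mem_image_of_mem _ ?_))
    refine ⟨fun i => ?_, fun i => ?_⟩
    · have := Int.floor_le (ξ i)
      simp
      linarith
    · have := Int.lt_floor_add_one (ξ i)
      simp
      linarith
  refine le_trans ?_ (le_ciSup habove ξ)
  refine le_ciInf fun p => ?_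
  rcases Int.units_eq_one_or p.1 with hp | hp
  · refine (h p.2).trans (le_of_eq ?_)
    congr 1
    ext i
    simp [hp]
  · refine (h fun i => -p.2 i).trans (le_of_eq ?_)
    rw [← qf_neg]
    congr 1
    ext i
    simp [hp]
    ring

end QuadraticForm

/-! ### Heisenberg action on coefficients and the lower bound for exponents -/

section Coefficients

variable {N : ℕ} {V : Type*} [NormedAddCommGroup V] [InnerProductSpace ℂ V] [FiniteDimensional ℂ V]
  {twok : ℤ} {M : Matrix (Fin N) (Fin N) ℚ} {ρ : Representation ℂ (JacobiGroup N) V}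
  {φ : ℍ → (Fin N → ℂ) → V} {c : ℝ → (Fin N → ℚ) → V}

theorem IsFourierExpansion.map (h : IsFourierExpansion φ c) (f : V →ₗ[ℂ] V) :
    IsFourierExpansion (fun τ z => f (φ τ z)) fun m r => f (c m r) := fun τ z => by
  have := (LinearMap.toContinuousLinearMap f).hasSum (h τ z)
  simpa using this

/-- Invariance of the Fourier coefficients under the Heisenberg group. -/
theorem IsJacobiForm.rho_coeff (hM : (toR M).PosDef) (hφ : IsJacobiForm twok M ρ φ)
    (h : IsFourierExpansion φ c) (l : Fin N → ℤ) (m : ℝ) (r : Fin N → ℚ) :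
    ρ (heis l 0 0) (c m r) =
      c (m - ((r ⬝ᵥ fun i => (l i : ℚ) : ℚ) : ℝ) + ((qf M fun i => (l i : ℚ) : ℚ) : ℝ) / 2)
        (r - M *ᵥ fun i => (l i : ℚ)) := by
  set lq : Fin N → ℚ := fun i => (l i : ℚ) with hlq
  -- `E p` is the index whose term acquires exponent `p` after substituting `z + lτ` and multiplying
  -- by the Heisenberg factor. Uniqueness then compares coefficients.
  let E : ℝ × (Fin N → ℚ) ≃ ℝ × (Fin N → ℚ) :=
    { toFun := fun p => (p.1 - ((p.2 ⬝ᵥ lq : ℚ) : ℝ) + ((qf M lq : ℚ) : ℝ) / 2, p.2 - M *ᵥ lq)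
      invFun := fun p => (p.1 + ((p.2 ⬝ᵥ lq : ℚ) : ℝ) + ((qf M lq : ℚ) : ℝ) / 2, p.2 + M *ᵥ lq)
      left_inv := fun p => by
        refine Prod.ext ?_ (by simp)
        simp only [sub_dotProduct, qf, dotProduct_comm lq]
        push_cast
        ring
      right_inv := fun p => by
        refine Prod.ext ?_ (by simp)
        simp only [add_dotProduct, qf, dotProduct_comm lq]
        push_cast
        ring }
  have h2 : IsFourierExpansion (fun τ z => ρ (heis l 0 0) (φ τ z))
      fun m r => c (E (m, r)).1 (E (m, r)).2 := by
    intro τ z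
    simp only [hφ.rho_heis]
    have h3 := (h τ fun i => z i + l i * τ + (0 : Fin N → ℤ) i).const_smul
      (e ((1 / 2) * (qf (toC M) (fun i => (l i : ℂ)) * τ
      + 2 * ((fun i => (l i : ℂ)) ⬝ᵥ (toC M *ᵥ z))
      + (toC M * ((0 : Matrix (Fin N) (Fin N) ℤ) +
        Matrix.vecMulVec (0 : Fin N → ℤ) l).map (fun n => (n : ℂ))).trace)))
    refine (E.hasSum_iff.2 h3).congr_fun fun p => ?_
    simp only [Function.comp_apply, Prod.mk.eta, smul_smul, ← e_add]
    congr 2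
    have e1 : (toC M *ᵥ fun i => (l i : ℂ)) = fun i => (((M *ᵥ lq) i : ℚ) : ℂ) := by
      ext i
      simp [Matrix.mulVec, dotProduct, hlq]
    have e2 : qf (toC M) (fun i => (l i : ℂ)) = ((qf M lq : ℚ) : ℂ) := by
      rw [qf, e1]
      simp [qf, dotProduct, hlq]
    have e3 : (fun i => (l i : ℂ)) ⬝ᵥ (toC M *ᵥ z) =
        (fun i => (((M *ᵥ lq) i : ℚ) : ℂ)) ⬝ᵥ z := by
      rw [dotProduct_mulVec_symm (toC_transpose hM), e1]
    have e4 : ∀ q : Fin N → ℚ, ((fun i => (q i : ℂ)) ⬝ᵥ fun i => z i + l i * τ + ((0 : Fin N → ℤ) i : ℂ)) =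
        (fun i => (q i : ℂ)) ⬝ᵥ z + ((q ⬝ᵥ lq : ℚ) : ℂ) * τ := by
      intro q
      simp only [dotProduct, hlq]
      push_cast
      rw [Finset.sum_mul, ← Finset.sum_add_distrib]
      exact Finset.sum_congr rfl fun i _ => by simp; ring
    have e5 : (fun i => ((p.2 i : ℚ) : ℂ)) ⬝ᵥ z = (fun i => (((E p).2 i : ℚ) : ℂ)) ⬝ᵥ z +
        (fun i => (((M *ᵥ lq) i : ℚ) : ℂ)) ⬝ᵥ z := by
      rw [← add_dotProduct]
      congr 1
      ext i
      simp [E]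
    have e6 : ((E p).2 ⬝ᵥ lq) = p.2 ⬝ᵥ lq - qf M lq := by
      simp [E, sub_dotProduct, qf, dotProduct_comm lq]
    rw [e2, e3, e4, e5, e6]
    simp [E]
    ring
  have := congrFun (congrFun ((h.map (ρ (heis l 0 0))).unique h2) m) r
  exact this

theorem IsJacobiForm.exponent_ge (hM : (toR M).PosDef) (hφ : IsJacobiForm twok M ρ φ)
    (h : IsFourierExpansion φ c) {B : ℝ}
    (hc : ∀ (m : ℝ) (r : Fin N → ℚ), 0 ≤ m → m < B + rd M / 2 → c m r = 0) {m : ℝ} {r : Fin N → ℚ}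
    (hmr : c m r ≠ 0) (α : Fin N → ℝ) :
    B ≤ m + (fun i => (r i : ℝ)) ⬝ᵥ α + qf (toR M) α / 2 := by
  have hb : ∀ β : Fin N → ℚ, IsBoundedAtImInfty fun τ => φ τ fun i => (β i : ℂ) := by
    intro β
    have := hφ.bounded 0 β
    simpa [qf, e_zero] using this
  have hge : ∀ m r, c m r ≠ 0 → B + rd M / 2 ≤ m := by
    intro m r hne
    by_contra! hlt
    rcases lt_or_ge m 0 with hm | hm
    · exact hne (h.eq_zero_of_neg hb hm r)
    · exact hne (hc m r hm hlt)
  have hsymm := toR_transpose hM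
  -- `ξ = -M⁻¹r` is the real vector minimising `m + r·α + ½M[α]`, with minimum `m - ½M[ξ]`.
  obtain ⟨ξ, hξ⟩ : ∃ ξ : Fin N → ℝ, toR M *ᵥ ξ = -fun i => (r i : ℝ) :=
    ⟨(toR M)⁻¹ *ᵥ (-fun i => (r i : ℝ)), by
      rw [Matrix.mulVec_mulVec, Matrix.mul_nonsing_inv _ ((Matrix.isUnit_iff_isUnit_det _).1 hM.isUnit),
        Matrix.one_mulVec]⟩
  have hrd : 2 * (B + rd M / 2 - m) + qf (toR M) ξ ≤ rd M := by
    refine le_rd hM (ξ := ξ) fun l => ?_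
    -- The translated coefficient is nonzero as well, so its exponent `m - ½M[ξ] + ½M[ξ + l]` is at
    -- least `B + ½ rd(M)`, for every `l`.
    have hne : ρ (heis l 0 0) (c m r) ≠ 0 := by
      intro h0
      refine hmr ?_
      have := rho_mul_apply (ρ := ρ) (heis l 0 0)⁻¹ (heis l 0 0) (c m r)
      rw [h0, map_zero, inv_mul_cancel, map_one] at this
      exact this
    rw [hφ.rho_coeff hM h] at hne
    have h1 := hge _ _ hne
    have h2 : ((r ⬝ᵥ fun i => (l i : ℚ) : ℚ) : ℝ) = (fun i => (r i : ℝ)) ⬝ᵥ fun i => (l i : ℝ) := by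
      simp [dotProduct]
    have h3 : ((qf M fun i => (l i : ℚ) : ℚ) : ℝ) = qf (toR M) fun i => (l i : ℝ) := by
      simp [qf, Matrix.mulVec, dotProduct]
    rw [h2, h3] at h1
    rw [add_comm ξ, qf_add hsymm, hξ, dotProduct_neg, dotProduct_comm]
    linarith
  have h4 := qf_toR_nonneg hM (α + -ξ)
  rw [qf_add hsymm, qf_neg, Matrix.mulVec_neg, hξ, neg_neg, dotProduct_comm] at h4
  linarith

end Coefficients

/-! ### Metaplectic lifts and the eta function -/

namespace Mp

/-- The projection `Mp₂(ℤ) → SL₂(ℤ)`. -/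
def toSL : Mp →* SL(2, ℤ) where
  toFun g := g.γ
  map_one' := rfl
  map_mul' _ _ := rfl

/-- It is enough to lift the generators: `S` by a branch of `√τ`, and `T` by the constant `1`. -/
theorem toSL_surjective : Function.Surjective toSL := by
  rw [← MonoidHom.range_eq_top, ← top_le_iff, ← SpecialLinearGroup.SL2Z_generators,
    Subgroup.closure_le]
  rintro γ (rfl | rfl)
  · refine ⟨⟨ModularGroup.S, fun τ => (τ : ℂ) ^ (((2 : ℕ) : ℂ)⁻¹), ?_, fun τ => ?_⟩, rfl⟩
    · rw [UpperHalfPlane.mdifferentiable_iff]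
      have : DifferentiableOn ℂ (fun w : ℂ => w ^ (((2 : ℕ) : ℂ)⁻¹)) {w | 0 < w.im} := by
        intro w hw
        refine (differentiableAt_id.cpow_const ?_).differentiableWithinAt
        exact Or.inr (ne_of_gt hw)
      refine this.congr fun w hw => ?_
      simp only [Function.comp_apply]
      rw [ofComplex_apply_of_im_pos hw]
    · rw [Complex.cpow_nat_inv_pow _ two_ne_zero]
      simp [cd, ModularGroup.S]
  · exact ⟨(transl 0).mp, rfl⟩

end Mp

theorem pow_left_injective_of_nonneg {n : ℕ} [NeZero n] {x y : ℝ} (hx : 0 ≤ x) (hy : 0 ≤ y)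
    (h : x ^ n = y ^ n) : x = y :=
  (pow_left_inj₀ hx hy (NeZero.ne n)).1 h

/-- Take norms in the weight 12 law for `Δ = η²⁴` and extract the nonnegative 24th root; the
multiplier system of `η` never enters. -/
theorem norm_eta_smul (g : Mp) (τ : ℍ) :
    ‖ModularForm.eta (g.γ • τ : ℍ)‖ = ‖g.ω τ‖ * ‖ModularForm.eta τ‖ := by
  have h := congrFun (SlashInvariantForm.slash_action_generators_SL2Z
    ModularForm.discriminant_S_invariant ModularForm.discriminant_T_invariant g.γ) τ
  rw [ModularForm.SL_slash_apply, ← cd_eq_denom, zpow_neg, ← div_eq_mul_inv,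
    div_eq_iff (zpow_ne_zero _ (cd_ne_zero _ _)), ← g.sq] at h
  have h2 : ‖ModularForm.discriminant (g.γ • τ)‖ = ‖g.ω τ‖ ^ 24 * ‖ModularForm.discriminant τ‖ := by
    rw [h, norm_mul, norm_zpow, norm_pow, mul_comm, ← zpow_natCast, ← zpow_mul, ← zpow_natCast]
    norm_num
  rw [ModularForm.discriminant, ModularForm.discriminant, norm_pow, norm_pow, ← mul_pow] at h2
  exact pow_left_injective_of_nonneg (norm_nonneg _) (by positivity) h2

/-! ### The invariant norm -/

section Invariance

variable {N : ℕ} {M : Matrix (Fin N) (Fin N) ℚ}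

theorem qf_toC_re_add_im (hM : (toR M).PosDef) (z : Fin N → ℂ) :
    qf (toC M) z = ((qf (toR M) (fun i => (z i).re) - qf (toR M) (fun i => (z i).im) : ℝ) : ℂ) +
      ((2 * ((fun i => (z i).re) ⬝ᵥ (toR M *ᵥ fun i => (z i).im)) : ℝ) : ℂ) * Complex.I := by
  have hz : z = (fun i => ((z i).re : ℂ)) + Complex.I • fun i => ((z i).im : ℂ) := by
    ext i
    simp [mul_comm Complex.I, Complex.re_add_im]
  have hcast : ∀ x y : Fin N → ℝ, ((x ⬝ᵥ (toR M *ᵥ y) : ℝ) : ℂ) =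
      (fun i => (x i : ℂ)) ⬝ᵥ (toC M *ᵥ fun i => (y i : ℂ)) := by
    intro x y
    simp [dotProduct, Matrix.mulVec]
  conv_lhs => rw [hz, qf_add (toC_transpose hM), qf_smul, Matrix.mulVec_smul, dotProduct_smul]
  simp only [qf]
  push_cast
  rw [hcast, hcast, hcast, Complex.I_sq, smul_eq_mul]
  ring

/-- The defect of `M[Im z] / Im τ` under `(τ, z) ↦ (γτ, z / (cτ+d))` is exactly what the index `M`
factor of the slash action compensates. -/
theorem qf_im_div (hM : (toR M).PosDef) (γ : SL(2, ℤ)) (τ : ℍ) (z : Fin N → ℂ) :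
    qf (toR M) (fun i => (z i / cd γ τ).im) / (γ • τ).im =
      qf (toR M) (fun i => (z i).im) / τ.im - ((γ 1 0 : ℂ) * qf (toC M) z / cd γ τ).im := by
  have hv := τ.im_pos
  have hn : 0 < Complex.normSq (cd γ τ) := Complex.normSq_pos.2 (cd_ne_zero _ _)
  have hre : (cd γ τ).im = γ 1 0 * τ.im := by simp [cd]
  have hnq : Complex.normSq (cd γ τ) = (cd γ τ).re ^ 2 + (γ 1 0 * τ.im) ^ 2 := by
    rw [Complex.normSq_apply, hre]
    ring
  have h1 : (fun i => (z i / cd γ τ).im) = ((cd γ τ).re / Complex.normSq (cd γ τ)) •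
      (fun i => (z i).im) + (-(γ 1 0 * τ.im / Complex.normSq (cd γ τ))) • fun i => (z i).re := by
    ext i
    rw [Complex.div_im, hre]
    simp
    ring
  have h2 : (fun i => (z i).im) ⬝ᵥ (toR M *ᵥ fun i => (z i).re) =
      (fun i => (z i).re) ⬝ᵥ (toR M *ᵥ fun i => (z i).im) := by
    rw [dotProduct_mulVec_symm (toR_transpose hM), dotProduct_comm]
  rw [ModularGroup.im_smul_eq_div_normSq, ← cd_eq_denom, h1, qf_add (toR_transpose hM), qf_smul,
    qf_smul, Matrix.mulVec_smul, dotProduct_smul, smul_dotProduct, h2, qf_toC_re_add_im hM,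
    Complex.div_im, hre]
  simp only [Complex.mul_im, Complex.mul_re, Complex.add_im, Complex.add_re, Complex.ofReal_re,
    Complex.ofReal_im, Complex.I_re, Complex.I_im, Complex.intCast_re, Complex.intCast_im, smul_eq_mul]
  set q1 := qf (toR M) fun i => (z i).re
  set q2 := qf (toR M) fun i => (z i).im
  set n := Complex.normSq (cd γ τ)
  field_simp
  rw [hnq]
  ring

variable {V : Type*} [NormedAddCommGroup V] [InnerProductSpace ℂ V]
  {twok : ℤ} {ρ : Representation ℂ (JacobiGroup N) V} {φ : ℍ → (Fin N → ℂ) → V}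

/-- The point `α τ + β` of `ℂᴺ`. -/
def line (τ : ℍ) (α β : Fin N → ℝ) : Fin N → ℂ := fun i => (α i : ℂ) * (τ : ℂ) + (β i : ℂ)

theorem line_im (τ : ℍ) (α β : Fin N → ℝ) : (fun i => (line τ α β i).im) = τ.im • α := by
  ext i
  simp [line, mul_comm]

theorem exists_eq_line (τ : ℍ) (z : Fin N → ℂ) : ∃ α β : Fin N → ℝ, z = line τ α β := by
  refine ⟨fun i => (z i).im / τ.im, fun i => (z i).re - (z i).im / τ.im * τ.re, ?_⟩
  have hv := τ.im_pos.ne'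
  ext i
  apply Complex.ext
  · simp [line]
  · simp [line, hv]

/-- The function `e(½ M[α] τ) φ(τ, α τ + β)`. -/
def specialize (M : Matrix (Fin N) (Fin N) ℚ) (φ : ℍ → (Fin N → ℂ) → V) (α β : Fin N → ℝ) (τ : ℍ) :
    V :=
  e ((qf (toR M) α / 2 : ℝ) * τ) • φ τ (line τ α β)

/-- The norm `‖η(τ)‖^(-2k) ‖e(½ M[α] τ) φ(τ, α τ + β)‖`, invariant under the Jacobi group. -/
def invNorm (twok : ℤ) (M : Matrix (Fin N) (Fin N) ℚ) (φ : ℍ → (Fin N → ℂ) → V) (τ : ℍ)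
    (α β : Fin N → ℝ) : ℝ :=
  ‖ModularForm.eta τ‖ ^ (-twok) * ‖specialize M φ α β τ‖

theorem norm_specialize (α β : Fin N → ℝ) (τ : ℍ) : ‖specialize M φ α β τ‖ =
    Real.exp (-Real.pi * (qf (toR M) (fun i => (line τ α β i).im) / τ.im)) *
      ‖φ τ (line τ α β)‖ := by
  have hv := τ.im_pos.ne'
  rw [specialize, norm_smul, norm_e, line_im, qf_smul, Complex.im_ofReal_mul]
  congr 2
  rw [UpperHalfPlane.coe_im]
  field_simp

theorem invNorm_translate (hM : (toR M).PosDef) (hφ : IsJacobiForm twok M ρ φ)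
    (hρ : ∀ (g : JacobiGroup N) (v w : V), inner ℂ (ρ g v) (ρ g w) = inner ℂ v w) (τ : ℍ)
    (α β : Fin N → ℝ) (l m : Fin N → ℤ) :
    invNorm twok M φ τ (fun i => α i + l i) (fun i => β i + m i) = invNorm twok M φ τ α β := by
  -- This `κ` cancels `μ λᵗ` and removes the trace term.
  have h := congrArg norm (hφ.rho_heis l m (-Matrix.vecMulVec m l) τ (line τ α β))
  rw [norm_map_of_inner_map (hρ _), norm_smul] at h
  rw [invNorm, invNorm, specialize, specialize, norm_smul, norm_smul, h, ← mul_assoc ‖e _‖, ← norm_mul,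
    ← e_add]
  have hz : line τ (fun i => α i + l i) (fun i => β i + m i) =
      fun i => line τ α β i + l i * τ + m i := by
    ext i
    simp only [line]
    push_cast
    ring
  rw [hz]
  congr 2
  have h1 : qf (toR M) (fun i => α i + l i) = qf (toR M) α +
      2 * (α ⬝ᵥ (toR M *ᵥ fun i => (l i : ℝ))) + qf (toR M) fun i => (l i : ℝ) :=
    qf_add (toR_transpose hM) α fun i => (l i : ℝ)
  have hcast : ∀ x y : Fin N → ℝ, (fun i => (x i : ℂ)) ⬝ᵥ (toC M *ᵥ fun i => (y i : ℂ)) =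
      ((x ⬝ᵥ (toR M *ᵥ y) : ℝ) : ℂ) := by
    intro x y
    simp [dotProduct, Matrix.mulVec]
  have h2 : qf (toC M) (fun i => (l i : ℂ)) = ((qf (toR M) fun i => (l i : ℝ) : ℝ) : ℂ) := by
    rw [qf, qf, ← hcast]
    simp
  have h3 : (fun i => (l i : ℂ)) ⬝ᵥ (toC M *ᵥ line τ α β) =
      ((α ⬝ᵥ (toR M *ᵥ fun i => (l i : ℝ)) : ℝ) : ℂ) * τ +
        ((β ⬝ᵥ (toR M *ᵥ fun i => (l i : ℝ)) : ℝ) : ℂ) := by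
    have : line τ α β = (τ : ℂ) • (fun i => (α i : ℂ)) + fun i => (β i : ℂ) := by
      ext i
      simp [line, mul_comm]
    rw [dotProduct_mulVec_symm (toC_transpose hM), dotProduct_comm, this, add_dotProduct,
      smul_dotProduct, ← hcast, ← hcast]
    simp [mul_comm]
  rw [norm_e, norm_e, h2, h3, h1]
  congr 2
  simp
  ring

theorem invNorm_smul (hM : (toR M).PosDef) (hφ : IsJacobiForm twok M ρ φ)
    (hρ : ∀ (g : JacobiGroup N) (v w : V), inner ℂ (ρ g v) (ρ g w) = inner ℂ v w) (γ : SL(2, ℤ))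
    (τ : ℍ) (α β : Fin N → ℝ) :
    ∃ α' β', invNorm twok M φ (γ • τ) α' β' = invNorm twok M φ τ α β := by
  obtain ⟨g, rfl⟩ := Mp.toSL_surjective γ
  change ∃ α' β', invNorm twok M φ (g.γ • τ) α' β' = _
  obtain ⟨α', β', h'⟩ := exists_eq_line (g.γ • τ) fun i => line τ α β i / cd g.γ τ
  refine ⟨α', β', ?_⟩
  have h := congrArg norm (hφ.rho_apply ⟨g, 0, 0, 0⟩ τ (line τ α β))
  rw [norm_map_of_inner_map (hρ _), norm_smul, norm_mul] at h
  have hs : shift (⟨g, 0, 0, 0⟩ : JacobiGroup N) τ (line τ α β) = line τ α β := by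
    ext i
    simp [shift]
  have hE : expFactor M (⟨g, 0, 0, 0⟩ : JacobiGroup N) τ (line τ α β) =
      e (-(1 / 2) * ((g.γ 1 0 : ℂ) * qf (toC M) (line τ α β) / cd g.γ τ)) := by
    rw [expFactor, hs]
    congr 1
    simp [qf]
    ring
  rw [hs, hE] at h
  rw [invNorm, invNorm, norm_specialize, norm_specialize, ← h', h, norm_eta_smul, norm_e, mul_zpow]
  have h2 := qf_im_div hM g.γ τ (line τ α β)
  beta_reduce
  rw [h2, norm_zpow]
  have h4 : ∀ X : ℂ, (-(1 / 2) * X).im = -X.im / 2 := fun X => by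
    rw [show (-(1 / 2) : ℂ) = ((-(1 / 2) : ℝ) : ℂ) by push_cast; rfl, Complex.im_ofReal_mul]
    ring
  rw [h4, mul_sub, sub_eq_add_neg, Real.exp_add]
  ring_nf

end Invariance

/-! ### Decay at the cusp -/

section Decay

variable {N : ℕ} {M : Matrix (Fin N) (Fin N) ℚ} {V : Type*} [NormedAddCommGroup V]
  [InnerProductSpace ℂ V] [FiniteDimensional ℂ V] {twok : ℤ} {φ : ℍ → (Fin N → ℂ) → V}
  {c : ℝ → (Fin N → ℚ) → V}

/-- A majorant of the Fourier series at `Im τ = 1/2`, uniform for `α` in the unit cube. -/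
theorem IsFourierExpansion.summable_majorant (h : IsFourierExpansion φ c) :
    Summable fun p : ℝ × (Fin N → ℚ) =>
      Real.exp (-Real.pi * p.1) * (∏ i, (1 + Real.exp (-Real.pi * p.2 i))) * ‖c p.1 p.2‖ := by
  classical
  simp only [Finset.prod_one_add, Finset.mul_sum, Finset.sum_mul]
  refine summable_sum fun s _ => ?_
  -- Each subset `s` in the expanded product corresponds to the corner `z = (i/2) 1_s`, where the
  -- Fourier series converges absolutely.
  have h1 := h.summable_norm (mkH 0 (v := 1 / 2) (by norm_num))
    fun i => if i ∈ s then ((1 / 2 : ℝ) : ℂ) * Complex.I else 0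
  refine h1.congr fun p => ?_
  have him : ((fun i => (p.2 i : ℂ)) ⬝ᵥ
      fun i => if i ∈ s then ((1 / 2 : ℝ) : ℂ) * Complex.I else 0).im =
      ∑ i ∈ s, (p.2 i : ℝ) * (1 / 2) := by
    simp only [dotProduct, mul_ite, mul_zero, Finset.sum_ite_mem, Finset.univ_inter, Complex.im_sum]
    refine Finset.sum_congr rfl fun i _ => ?_
    rw [← Complex.ofReal_ratCast, Complex.im_ofReal_mul, Complex.im_ofReal_mul, Complex.I_im, mul_one]
  rw [norm_smul, norm_mul, norm_e, norm_e, ← Real.exp_sum, him, Finset.mul_sum, coe_mkH]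
  congr 3
  · simp
    ring
  · exact Finset.sum_congr rfl fun i _ => by ring

theorem exp_mul_le_one_add {t a : ℝ} (ha : a ∈ Icc (0 : ℝ) 1) : Real.exp (t * a) ≤ 1 + Real.exp t := by
  rcases le_total 0 t with ht | ht
  · have : Real.exp (t * a) ≤ Real.exp t := Real.exp_le_exp.2 (mul_le_of_le_one_right ht ha.2)
    linarith
  · have : Real.exp (t * a) ≤ 1 := Real.exp_le_one_iff.2 (mul_nonpos_of_nonpos_of_nonneg ht ha.1)
    have := Real.exp_pos t
    linarith

theorem norm_specialize_le (hM : (toR M).PosDef) (h : IsFourierExpansion φ c) {B : ℝ}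
    (hB : ∀ m r, c m r ≠ 0 → ∀ α : Fin N → ℝ,
      B ≤ m + (fun i => (r i : ℝ)) ⬝ᵥ α + qf (toR M) α / 2) :
    ∃ C : ℝ, ∀ (τ : ℍ) (α β : Fin N → ℝ), 1 / 2 ≤ τ.im → α ∈ Icc (0 : Fin N → ℝ) 1 →
      ‖specialize M φ α β τ‖ ≤ C * Real.exp (-2 * Real.pi * B * τ.im) := by
  have hs := h.summable_majorant
  -- For an exponent `E ≥ B` and `v ≥ 1/2`, `exp(-2πEv) ≤ exp(πB) exp(-2πBv) exp(-πE)`. The last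
  -- factor is bounded by the majorant at height `1/2` after dropping `½M[α] ≥ 0`.
  refine ⟨Real.exp (Real.pi * B) * ∑' p : ℝ × (Fin N → ℚ), Real.exp (-Real.pi * p.1) *
    (∏ i, (1 + Real.exp (-Real.pi * p.2 i))) * ‖c p.1 p.2‖, fun τ α β hτ hα => ?_⟩
  have h1 := (h τ (line τ α β)).const_smul (e ((qf (toR M) α / 2 : ℝ) * τ))
  rw [specialize, ← h1.tsum_eq]
  refine (tsum_of_norm_bounded (hs.hasSum.mul_left
    (Real.exp (Real.pi * B) * Real.exp (-2 * Real.pi * B * τ.im))) fun p => ?_).trans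
    (le_of_eq (by ring))
  by_cases hp : c p.1 p.2 = 0
  · simp [hp]
  have hE := hB p.1 p.2 hp α
  rw [norm_smul, norm_smul, norm_mul, norm_e, norm_e, norm_e, ← mul_assoc, ← mul_assoc,
    ← mul_assoc]
  refine mul_le_mul_of_nonneg_right ?_ (norm_nonneg _)
  have him : ((fun i => (p.2 i : ℂ)) ⬝ᵥ line τ α β).im = ((fun i => (p.2 i : ℝ)) ⬝ᵥ α) * τ.im := by
    simp only [dotProduct, line, Complex.im_sum, Finset.sum_mul]
    refine Finset.sum_congr rfl fun i _ => ?_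
    rw [← Complex.ofReal_ratCast, Complex.im_ofReal_mul]
    simp
    ring
  have hprod : Real.exp (-Real.pi * ((fun i => (p.2 i : ℝ)) ⬝ᵥ α)) ≤
      ∏ i, (1 + Real.exp (-Real.pi * p.2 i)) := by
    simp only [dotProduct]
    rw [Finset.mul_sum, Real.exp_sum]
    refine Finset.prod_le_prod (fun _ _ => (Real.exp_pos _).le) fun i _ => ?_
    rw [← mul_assoc]
    exact exp_mul_le_one_add ⟨hα.1 i, hα.2 i⟩
  rw [him, Complex.im_ofReal_mul, Complex.im_ofReal_mul, UpperHalfPlane.coe_im, ← Real.exp_add,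
    ← Real.exp_add, ← Real.exp_add]
  refine le_trans ?_ (mul_le_mul_of_nonneg_left
    (mul_le_mul_of_nonneg_left hprod (Real.exp_pos _).le) (Real.exp_pos _).le)
  rw [← Real.exp_add, ← Real.exp_add, Real.exp_le_exp]
  have hq := qf_toR_nonneg hM α
  have hpi := Real.pi_pos
  have h3 := mul_nonneg (sub_nonneg.2 hE) (sub_nonneg.2 hτ)
  have h4 := mul_nonneg hpi.le h3
  have h5 := mul_nonneg hpi.le hq
  nlinarith

/-- The product formula for `Δ` has leading factor `q`; the 24th root of norms gives the growth rate
of `η`. -/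
theorem tendsto_norm_eta_mul_exp : Tendsto (fun τ : ℍ =>
    ‖ModularForm.eta τ‖ * Real.exp (2 * Real.pi * τ.im / 24)) atImInfty (𝓝 1) := by
  have h := ModularForm.tendsto_atImInfty_tprod_one_sub_eta_q_pow.norm
  rw [norm_one] at h
  have h2 := h.rpow_const (p := (24 : ℝ)⁻¹) (Or.inl one_ne_zero)
  rw [Real.one_rpow] at h2
  refine h2.congr fun τ => ?_
  have h3 : ‖∏' n, (1 - ModularForm.eta_q n τ) ^ 24‖ =
      (‖ModularForm.eta τ‖ * Real.exp (2 * Real.pi * τ.im / 24)) ^ (24 : ℕ) := by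
    have h4 := congrArg norm (ModularForm.discriminant_eq_q_prod τ)
    have hq : ‖Function.Periodic.qParam 1 (τ : ℂ)‖ = Real.exp (-(2 * Real.pi * τ.im)) := by
      simp [Function.Periodic.qParam, Complex.norm_exp]
    rw [norm_mul, hq, ModularForm.discriminant, norm_pow] at h4
    rw [mul_pow, h4, ← Real.exp_nat_mul, mul_right_comm, ← Real.exp_add]
    have : -(2 * Real.pi * τ.im) + ((24 : ℕ) : ℝ) * (2 * Real.pi * τ.im / 24) = 0 := by
      push_cast
      ring
    rw [this, Real.exp_zero, one_mul]
  rw [h3]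
  exact Real.pow_rpow_inv_natCast (by positivity) (by norm_num)

/-- If all exponents are at least `k / 12 + 1`, then the invariant norm decays at the cusp, uniformly
for `α` in the unit cube. -/
theorem exists_invNorm_lt (hM : (toR M).PosDef) (h : IsFourierExpansion φ c)
    (hB : ∀ m r, c m r ≠ 0 → ∀ α : Fin N → ℝ,
      (twok : ℝ) / 2 / 12 + 1 ≤ m + (fun i => (r i : ℝ)) ⬝ᵥ α + qf (toR M) α / 2) {ε : ℝ}
    (hε : 0 < ε) : ∃ Y : ℝ, ∀ (τ : ℍ) (α β : Fin N → ℝ), Y ≤ τ.im → α ∈ Icc (0 : Fin N → ℝ) 1 →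
      invNorm twok M φ τ α β < ε := by
  obtain ⟨C, hC⟩ := norm_specialize_le hM h hB
  -- The eta factor accounts for `k/12` of the exponent `B = k/12 + 1`, leaving `exp(-2π Im τ)`.
  have h1 := (tendsto_norm_eta_mul_exp.zpow₀ (-twok) (Or.inl one_ne_zero)).mul
    ((Real.tendsto_exp_atBot.comp ((tendsto_comap : Tendsto UpperHalfPlane.im atImInfty atTop).const_mul_atTop_of_neg
      (by linarith [Real.pi_pos] : -2 * Real.pi < 0))).const_mul C)
  rw [mul_zero, mul_zero] at h1
  obtain ⟨Y, hY⟩ := (atImInfty_mem _).1 (h1.eventually (gt_mem_nhds hε))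
  refine ⟨max Y (1 / 2), fun τ α β hτ hα => ?_⟩
  refine lt_of_le_of_lt ?_ (hY τ ((le_max_left _ _).trans hτ))
  have h2 := mul_le_mul_of_nonneg_left (hC τ α β ((le_max_right _ _).trans hτ) hα)
    (by positivity : 0 ≤ ‖ModularForm.eta τ‖ ^ (-twok))
  refine h2.trans (le_of_eq ?_)
  have h3 : Real.exp (2 * Real.pi * τ.im / 24) ^ (-twok) =
      Real.exp (2 * Real.pi * τ.im / 24 * ((-twok : ℤ) : ℝ)) := by
    rw [Real.exp_mul, Real.rpow_intCast]
  rw [Function.comp_apply, mul_zpow, h3, mul_assoc (‖_‖ ^ _), mul_left_comm (Real.exp _),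
    ← Real.exp_add]
  congr 3
  push_cast
  ring

end Decay

/-! ### Maximum principle -/

section MaxPrinciple

variable {N : ℕ} {M : Matrix (Fin N) (Fin N) ℚ} {V : Type*} [NormedAddCommGroup V]
  [InnerProductSpace ℂ V] {twok : ℤ} {ρ : Representation ℂ (JacobiGroup N) V}
  {φ : ℍ → (Fin N → ℂ) → V} {c : ℝ → (Fin N → ℚ) → V}

theorem IsJacobiForm.continuous_invNorm (hφ : IsJacobiForm twok M ρ φ) :
    Continuous fun p : ℍ × (Fin N → ℝ) × (Fin N → ℝ) => invNorm twok M φ p.1 p.2.1 p.2.2 := by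
  have hη : Continuous fun τ : ℍ => ModularForm.eta τ := by
    refine continuous_iff_continuousAt.2 fun τ => ?_
    exact (ModularForm.differentiableAt_eta_of_mem_upperHalfPlaneSet τ.im_pos).continuousAt.comp
      UpperHalfPlane.continuous_coe.continuousAt
  have hφc : Continuous fun p : ℍ × (Fin N → ℝ) × (Fin N → ℝ) => φ p.1 (line p.1 p.2.1 p.2.2) := by
    have := hφ.holo.continuousOn.comp_continuous
      (f := fun p : ℍ × (Fin N → ℝ) × (Fin N → ℝ) => ((p.1 : ℂ), line p.1 p.2.1 p.2.2))
      (by unfold line; fun_prop) fun p => p.1.im_pos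
    exact this.congr fun p => by simp only [Function.comp_apply, ofComplex_apply]
  unfold invNorm specialize
  refine Continuous.mul ?_ (Continuous.norm (Continuous.smul ?_ hφc))
  · exact Continuous.zpow₀ (hη.comp continuous_fst).norm _ fun p =>
      Or.inl (norm_ne_zero_iff.2 (ModularForm.eta_ne_zero p.1.im_pos))
  · fun_prop

theorem IsJacobiForm.exists_mem_fd (hM : (toR M).PosDef) (hφ : IsJacobiForm twok M ρ φ)
    (hρ : ∀ (g : JacobiGroup N) (v w : V), inner ℂ (ρ g v) (ρ g w) = inner ℂ v w) (τ : ℍ)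
    (α β : Fin N → ℝ) : ∃ τ' ∈ ModularGroup.fd, ∃ α' ∈ Icc (0 : Fin N → ℝ) 1,
      ∃ β' ∈ Icc (0 : Fin N → ℝ) 1, invNorm twok M φ τ' α' β' = invNorm twok M φ τ α β := by
  obtain ⟨γ, hγ⟩ := ModularGroup.exists_smul_mem_fd τ
  obtain ⟨α', β', h⟩ := invNorm_smul hM hφ hρ γ τ α β
  have hfl : ∀ x : Fin N → ℝ, (fun i => x i + ((-⌊x i⌋ : ℤ) : ℝ)) ∈ Icc (0 : Fin N → ℝ) 1 := by
    refine fun x => ⟨fun i => ?_, fun i => ?_⟩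
    · have := Int.floor_le (x i)
      simp
      linarith
    · have := Int.lt_floor_add_one (x i)
      simp
      linarith
  exact ⟨γ • τ, hγ, _, hfl α', _, hfl β', (invNorm_translate hM hφ hρ _ _ _ _ _).trans h⟩

theorem IsJacobiForm.eq_zero_of_decay (hM : (toR M).PosDef) (hφ : IsJacobiForm twok M ρ φ)
    (hρ : ∀ (g : JacobiGroup N) (v w : V), inner ℂ (ρ g v) (ρ g w) = inner ℂ v w)
    (hdecay : ∀ ε > 0, ∃ Y : ℝ, ∀ (τ : ℍ) (α β : Fin N → ℝ), Y ≤ τ.im →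
      α ∈ Icc (0 : Fin N → ℝ) 1 → invNorm twok M φ τ α β < ε) : φ = 0 := by
  have hη : ∀ τ : ℍ, ModularForm.eta τ ≠ 0 := fun τ => ModularForm.eta_ne_zero τ.im_pos
  have hpos : ∀ τ α β, 0 ≤ invNorm twok M φ τ α β := fun τ α β => by
    unfold invNorm
    positivity
  suffices hz : ∀ τ α β, invNorm twok M φ τ α β = 0 by
    ext τ z
    obtain ⟨α, β, rfl⟩ := exists_eq_line τ z
    have h := hz τ α β
    rw [invNorm, mul_eq_zero, or_iff_right (zpow_ne_zero _ (norm_ne_zero_iff.2 (hη τ))), norm_eq_zero,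
      specialize, smul_eq_zero, or_iff_right (e_ne_zero _)] at h
    exact h
  by_contra! hne
  obtain ⟨τ₀, α₀, β₀, h₀⟩ := hne
  have h₀' : 0 < invNorm twok M φ τ₀ α₀ β₀ := lt_of_le_of_ne (hpos _ _ _) h₀.symm
  -- Above height `Y` the invariant norm is below its value at the chosen nonzero point, so the
  -- maximum over the compact truncated domain is a global one.
  obtain ⟨Y, hY⟩ := hdecay _ h₀'
  obtain ⟨τ₁, hτ₁, α₁, hα₁, β₁, hβ₁, h₁⟩ := hφ.exists_mem_fd hM hρ τ₀ α₀ β₀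
  have hτ₁Y : τ₁.im ≤ Y := by
    by_contra! hlt
    exact absurd h₁ (hY τ₁ α₁ β₁ hlt.le hα₁).ne
  obtain ⟨⟨τ₂, α₂, β₂⟩, ⟨hτ₂, hα₂, hβ₂⟩, hmax⟩ :=
    ((ModularGroup.isCompact_truncatedFundamentalDomain Y).prod
      ((isCompact_Icc (a := (0 : Fin N → ℝ)) (b := 1)).prod
        (isCompact_Icc (a := (0 : Fin N → ℝ)) (b := 1)))).exists_isMaxOn
      ⟨(τ₁, α₁, β₁), ⟨hτ₁, hτ₁Y⟩, hα₁, hβ₁⟩ hφ.continuous_invNorm.continuousOn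
  have h12 : invNorm twok M φ τ₀ α₀ β₀ ≤ invNorm twok M φ τ₂ α₂ β₂ := by
    rw [← h₁]
    exact hmax (a := (τ₁, α₁, β₁)) ⟨⟨hτ₁, hτ₁Y⟩, hα₁, hβ₁⟩
  have hglob : ∀ τ α β, invNorm twok M φ τ α β ≤ invNorm twok M φ τ₂ α₂ β₂ := by
    intro τ α β
    obtain ⟨τ', hτ', α', hα', β', hβ', h'⟩ := hφ.exists_mem_fd hM hρ τ α β
    rw [← h']
    rcases le_total τ'.im Y with hle | hle
    · exact hmax (a := (τ', α', β')) ⟨⟨hτ', hle⟩, hα', hβ'⟩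
    · exact (hY τ' α' β' hle hα').le.trans h12
  -- With `α₂, β₂` fixed, the invariant norm is the norm of a function holomorphic in `τ` alone.
  -- Only the supremum over `(α, β)` is controlled by invariance, hence the prior maximisation over
  -- all variables.
  let u : ℂ → V := fun w => ModularForm.eta w ^ (-twok) •
    e ((qf (toR M) α₂ / 2 : ℝ) * w) • φ (ofComplex w) fun i => α₂ i * w + β₂ i
  have hu : ∀ τ : ℍ, ‖u τ‖ = invNorm twok M φ τ α₂ β₂ := by
    intro τ
    simp only [u, ofComplex_apply]
    rw [norm_smul, norm_zpow]
    rfl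
  have hud : DifferentiableOn ℂ u upperHalfPlaneSet := by
    refine DifferentiableOn.smul (fun w hw => ?_) (DifferentiableOn.smul (by fun_prop) ?_)
    · exact ((ModularForm.differentiableAt_eta_of_mem_upperHalfPlaneSet hw).zpow
        (Or.inl (ModularForm.eta_ne_zero hw))).differentiableWithinAt
    · exact hφ.holo.comp (f := fun w : ℂ => (w, fun i => α₂ i * w + β₂ i)) (by fun_prop)
        fun w hw => hw
  have hconst := Complex.norm_eqOn_of_isPreconnected_of_isMaxOn
    (convex_halfSpace_im_gt 0).isPreconnected isOpen_upperHalfPlaneSet hud τ₂.im_pos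
    (fun w hw => by
      have h1 := hglob ⟨w, hw⟩ α₂ β₂
      rw [← hu, ← hu] at h1
      exact h1)
  have hv : 0 < max Y 1 := lt_of_lt_of_le one_pos (le_max_right _ _)
  have h3 := hconst (mkH 0 hv).im_pos
  simp only [Function.comp_apply, Function.const_apply, hu] at h3
  have h4 := hY (mkH 0 hv) α₂ β₂ (by rw [im_mkH]; exact le_max_left _ _) hα₂
  linarith

end MaxPrinciple

/-! ### Support of the coefficients and lattice duality -/

section Lattice

variable {N : ℕ}

/-- The lattice `M ℤᴺ + ℤᴺ`. -/
def sumLattice (M : Matrix (Fin N) (Fin N) ℚ) : AddSubgroup (Fin N → ℚ) where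
  carrier := {r | InSumLattice M r}
  zero_mem' := ⟨0, 0, by ext i; simp [Matrix.mulVec, dotProduct]⟩
  add_mem' := by
    rintro _ _ ⟨a, b, rfl⟩ ⟨a', b', rfl⟩
    refine ⟨a + a', b + b', ?_⟩
    have : (fun i => (((a + a') i : ℤ) : ℚ)) = (fun i => (a i : ℚ)) + fun i => (a' i : ℚ) := by
      ext
      simp
    rw [this, Matrix.mulVec_add]
    ext i
    simp
    ring
  neg_mem' := by
    rintro _ ⟨a, b, rfl⟩
    refine ⟨-a, -b, ?_⟩
    have : (fun i => (((-a) i : ℤ) : ℚ)) = -fun i => (a i : ℚ) := by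
      ext
      simp
    rw [this, Matrix.mulVec_neg]
    ext i
    simp [add_comm]

/-- Finitely many rationals have a common denominator. -/
theorem exists_common_denominator {ι : Type*} [Fintype ι] (q : ι → ℚ) :
    ∃ D : ℕ, 0 < D ∧ ∀ i, ∃ n : ℤ, q i = n / D := by
  classical
  refine ⟨∏ i, (q i).den, Finset.prod_pos fun i _ => (q i).pos, fun i => ?_⟩
  refine ⟨(q i).num * ∏ j ∈ Finset.univ.erase i, ((q j).den : ℤ), ?_⟩
  have h1 : (∏ j ∈ Finset.univ.erase i, ((q j).den : ℚ)) ≠ 0 :=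
    Finset.prod_ne_zero_iff.2 fun j _ => by exact_mod_cast (q j).den_ne_zero
  rw [← Finset.mul_prod_erase Finset.univ _ (Finset.mem_univ i)]
  push_cast
  rw [mul_div_mul_right _ _ h1, Rat.num_div_den]

/-- Biduality for the lattice `M ℤᴺ + ℤᴺ`, whose dual is `ℤᴺ ∩ M⁻¹ ℤᴺ`. -/
theorem inSumLattice_of_forall {M : Matrix (Fin N) (Fin N) ℚ} (hM : Mᵀ = M) {r : Fin N → ℚ}
    (h : ∀ μ ν : Fin N → ℤ, M *ᵥ (fun i => (μ i : ℚ)) = (fun i => (ν i : ℚ)) →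
      ∃ n : ℤ, r ⬝ᵥ (fun i => (μ i : ℚ)) = n) : InSumLattice M r := by
  by_contra hr
  have hr' : (QuotientAddGroup.mk r : (Fin N → ℚ) ⧸ sumLattice M) ≠ 0 := fun h0 =>
    hr ((QuotientAddGroup.eq_zero_iff r).1 h0)
  -- A `ℚ/ℤ`-valued character trivial on the lattice but not at `r`. On `(1/D)ℤᴺ`, which contains
  -- `r` and the rows of `M`, it is `s ↦ s·μ mod 1`; `μ` is integral because the character kills
  -- `ℤᴺ`, and `Mμ` is integral because it kills `Mℤᴺ`.
  obtain ⟨χ, hχ⟩ := CharacterModule.exists_character_apply_ne_zero_of_ne_zero hr'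
  let ψ : (Fin N → ℚ) →+ AddCircle (1 : ℚ) := χ.comp (QuotientAddGroup.mk' (sumLattice M))
  have hψ : ∀ s, InSumLattice M s → ψ s = 0 := fun s hs => by
    have : (QuotientAddGroup.mk' (sumLattice M)) s = 0 := (QuotientAddGroup.eq_zero_iff s).2 hs
    exact (congrArg χ this).trans (map_zero χ)
  obtain ⟨D, hD, hDq⟩ := exists_common_denominator
    (Sum.elim r fun p : Fin N × Fin N => M p.1 p.2)
  have hD0 : (D : ℚ) ≠ 0 := by exact_mod_cast hD.ne'
  choose q hq using fun i : Fin N => QuotientAddGroup.mk_surjective (ψ (Pi.single i (1 / D)))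
  have hDχ : ∀ i, ∃ n : ℤ, (n : ℚ) = D * q i := by
    intro i
    have h1 : ((D * q i : ℚ) : AddCircle (1 : ℚ)) = 0 := by
      have : ((D * q i : ℚ) : AddCircle (1 : ℚ)) = D • ψ (Pi.single i (1 / D)) := by
        rw [← hq, ← nsmul_eq_mul]
        rfl
      rw [this, ← map_nsmul, ← Pi.single_smul]
      refine hψ _ ⟨0, Pi.single i 1, ?_⟩
      ext j
      rcases eq_or_ne j i with rfl | hj
      · simp [hD0, Matrix.mulVec, dotProduct]
      · simp [hj, Matrix.mulVec, dotProduct]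
    obtain ⟨n, hn⟩ := (AddCircle.coe_eq_zero_iff 1).1 h1
    exact ⟨n, by simpa using hn⟩
  choose μ hμ using hDχ
  have key : ∀ s : Fin N → ℚ, (∀ i, ∃ n : ℤ, s i = n / D) →
      ψ s = ((s ⬝ᵥ fun i => (μ i : ℚ) : ℚ) : AddCircle (1 : ℚ)) := by
    intro s hs
    choose n hn using hs
    have h1 : s = ∑ i, n i • (Pi.single i (1 / D) : Fin N → ℚ) := by
      ext j
      simp only [Finset.sum_apply, Pi.smul_apply, Pi.single_apply]
      rw [Finset.sum_eq_single j]
      · simp [hn, div_eq_mul_inv]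
      · intro k _ hk
        simp [hk.symm]
      · simp
    have h2 : (s ⬝ᵥ fun i => (μ i : ℚ)) = ∑ i, n i • q i := by
      simp only [dotProduct]
      refine Finset.sum_congr rfl fun i _ => ?_
      rw [hn, hμ, zsmul_eq_mul]
      field_simp
    rw [h2, h1, map_sum]
    simp only [map_zsmul, ← hq]
    exact (map_sum (QuotientAddGroup.mk' (AddSubgroup.zmultiples (1 : ℚ))) (fun i => n i • q i)
      Finset.univ).symm
  have hM' : ∀ j, ∃ n : ℤ, (M *ᵥ fun i => (μ i : ℚ)) j = n := by
    intro j
    have h1 := key (fun i => M j i) fun i => hDq (Sum.inr (j, i))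
    rw [hψ _ ⟨Pi.single j 1, 0, by
      ext i
      have hs : (fun k => ((Pi.single j 1 : Fin N → ℤ) k : ℚ)) = Pi.single j 1 := by
        ext k
        rcases eq_or_ne k j with rfl | hk
        · simp
        · simp [hk]
      rw [hs]
      have := congrFun (congrFun hM j) i
      simp [Matrix.transpose_apply] at this
      simp [this]⟩] at h1
    obtain ⟨n, hn⟩ := (AddCircle.coe_eq_zero_iff 1).1 h1.symm
    exact ⟨n, by simpa [Matrix.mulVec] using hn.symm⟩
  choose ν hν using hM'
  obtain ⟨n, hn⟩ := h μ ν (funext hν)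
  refine hχ ?_
  change ψ r = 0
  rw [key r fun i => hDq (Sum.inl i), hn]
  exact (AddCircle.coe_eq_zero_iff 1).2 ⟨n, by simp⟩

variable {M : Matrix (Fin N) (Fin N) ℚ} {V : Type*} [NormedAddCommGroup V]
  [InnerProductSpace ℂ V] [FiniteDimensional ℂ V] {twok : ℤ}
  {ρ : Representation ℂ (JacobiGroup N) V} {φ : ℍ → (Fin N → ℂ) → V} {c : ℝ → (Fin N → ℚ) → V}

/-- Invariance under `z ↦ z + μ` multiplies `c(m, r)` by `e(r·μ)`, so uniqueness gives `r·μ ∈ ℤ`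
whenever the coefficient is nonzero; biduality finishes. -/
theorem IsJacobiForm.inSumLattice (hM : (toR M).PosDef) (hφ : IsJacobiForm twok M ρ φ)
    (h : IsFourierExpansion φ c)
    (hρ : ∀ μ ν : Fin N → ℤ, M *ᵥ (fun i => (μ i : ℚ)) = (fun i => (ν i : ℚ)) →
      ρ (heis 0 μ 0) = 1) {m : ℝ} {r : Fin N → ℚ} (hc : c m r ≠ 0) : InSumLattice M r := by
  refine inSumLattice_of_forall (transpose_eq_of_posDef hM) fun μ ν hμ => ?_
  have h2 : IsFourierExpansion φ fun m r => e ((r ⬝ᵥ fun i => (μ i : ℚ) : ℚ) : ℂ) • c m r := by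
    intro τ z
    have h3 : φ τ z = φ τ fun i => z i + μ i := by
      rw [← hφ.rho_heis_mu, hρ μ ν hμ, Module.End.one_apply]
    rw [h3]
    refine (h τ fun i => z i + μ i).congr_fun fun p => ?_
    rw [smul_smul, mul_assoc, ← e_add]
    congr 3
    simp [dotProduct, mul_add, Finset.sum_add_distrib]
  have h4 : c m r = e ((r ⬝ᵥ fun i => (μ i : ℚ) : ℚ) : ℂ) • c m r :=
    congrFun (congrFun (h.unique h2) m) r
  have h5 : e ((r ⬝ᵥ fun i => (μ i : ℚ) : ℚ) : ℂ) = 1 := by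
    by_contra hne
    refine hc ((smul_eq_zero.1 (?_ : (e ((r ⬝ᵥ fun i => (μ i : ℚ) : ℚ) : ℂ) - 1) • c m r = 0)).resolve_left
      (sub_ne_zero.2 hne))
    rw [sub_smul, one_smul, ← h4, sub_self]
  obtain ⟨n, hn⟩ := Complex.exp_eq_one_iff.1 h5
  refine ⟨n, ?_⟩
  have h6 : (2 * Real.pi * Complex.I : ℂ) ≠ 0 := Complex.two_pi_I_ne_zero
  rw [mul_comm (n : ℂ)] at hn
  exact_mod_cast mul_left_cancel₀ h6 hn

theorem IsJacobiForm.eq_zero_of_coeff (hM : (toR M).PosDef) (hφ : IsJacobiForm twok M ρ φ)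
    (hρ : ∀ (g : JacobiGroup N) (v w : V), inner ℂ (ρ g v) (ρ g w) = inner ℂ v w)
    (h : IsFourierExpansion φ c)
    (hc : ∀ (m : ℝ) (r : Fin N → ℚ), 0 ≤ m → m < ((twok : ℝ) / 2) / 12 + 1 + rd M / 2 →
      c m r = 0) : φ = 0 :=
  hφ.eq_zero_of_decay hM hρ fun _ hε => exists_invNorm_lt hM h
    (fun _ _ hmr α => hφ.exponent_ge hM h hc hmr α) hε

end Lattice

end JacobiForms
end

theorem mainTheorem4 {N : ℕ} (hN : 0 < N) (twok : ℤ) (M : Matrix (Fin N) (Fin N) ℚ)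
    (hM : (JacobiForms.toR M).PosDef)
    {V : Type*} [NormedAddCommGroup V] [InnerProductSpace ℂ V] [FiniteDimensional ℂ V]
    (ρ : Representation ℂ (JacobiForms.JacobiGroup N) V)
    (hρ : ∀ (g : JacobiForms.JacobiGroup N) (v w : V), inner ℂ (ρ g v) (ρ g w) = inner ℂ v w)
    (φ : UpperHalfPlane → (Fin N → ℂ) → V) (hφ : JacobiForms.IsJacobiForm twok M ρ φ) :
    (∃! c : ℝ → (Fin N → ℚ) → V, JacobiForms.IsFourierExpansion φ c) ∧
    ∀ c : ℝ → (Fin N → ℚ) → V, JacobiForms.IsFourierExpansion φ c →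
      ((∀ (m : ℝ) (r : Fin N → ℚ), 0 ≤ m → m < ((twok : ℝ) / 2) / 12 + 1 + JacobiForms.rd M / 2 →
          c m r = 0) → φ = 0) ∧
      ((∀ μ ν : Fin N → ℤ, M.mulVec (fun i => (μ i : ℚ)) = (fun i => (ν i : ℚ)) →
          ρ (JacobiForms.JacobiGroup.heis 0 μ 0) = 1) →
        (∀ (m : ℝ) (r : Fin N → ℚ), JacobiForms.InSumLattice M r →
          0 ≤ m → m < ((twok : ℝ) / 2) / 12 + 1 + JacobiForms.rd M / 2 → c m r = 0) → φ = 0) := by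
  refine ⟨?_, fun c hc => ⟨hφ.eq_zero_of_coeff hM hρ hc, fun htriv hvan => ?_⟩⟩
  · obtain ⟨c, hc⟩ := hφ.exists_isFourierExpansion hρ
    exact ⟨c, hc, fun c' hc' => hc'.unique hc⟩
  · refine hφ.eq_zero_of_coeff hM hρ hc fun m r h0 h1 => ?_
    by_contra hne
    exact hne (hvan m r (hφ.inSumLattice hM hc htriv hne) h0 h1)
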